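/- Let $U,V\in C^7(\mathbb R)$ and let $\lambda,K_V>0$ be such that, for all $x,y\in\mathbb R$, $(U'(x)-U'(y))(x-y)\ge\lambda|x-y|^2$; $V$ is even, $(V'(x)-V'(y))(x-y)\ge 0$ and $|V''|\le K_V$; the derivatives of $U$ and $V$ of orders $2,\dots,7$ are bounded; and $\lambda\ge 7K_V$. Let $\sigma\in\mathbb R$ and put $B_i(\boldsymbol x)=-U'(x_i)-\frac1N\sum_{j=1}^N V'(x_i-x_j)$ for $\boldsymbol x\in\mathbb R^N$. Let $\boldsymbol W=(W^1,\dots,W^N)$ be an $N$-dimensional Brownian motion with respect to a filtration $(\mathcal F_t)_{t\ge0}$ on a probability space. For $t\ge 0$ and an $\mathcal F_t$-measurable random vector $\boldsymbol x=(x_1,\dots,x_N)$, let $\boldsymbol X^{t,\boldsymbol x}=(X^{t,1},\dots,X^{t,N})$ be the continuous adapted solution on $[t,\infty)$ of $$X^{t,i}_s=x_i+\int_t^s B_i(\boldsymbol X^{t,\boldsymbol x}_u)\,du+\sigma(W^i_s-W^i_t),\qquad 1\le i\le N,$$ and let its first variation process $(X^{t,i}_{s,x_j})_{1\le i,j\le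 N}$ be the continuous adapted solution on $[t,\infty)$ of $$X^{t,i}_{s,x_j}=\delta_{i,j}+\int_t^s\sum_{l=1}^N\partial_{x_l}B_i(\boldsymbol X^{t,\boldsymbol x}_u)\,X^{t,l}_{u,x_j}\,du .$$ Then for every $\lambda_1\in(0,\lambda)$ there exist $\lambda_2\in(0,\min\{\lambda-2K_V,\lambda_1\})$ and $\lambda_3\in(0,\min\{\lambda-2K_V,\lambda_2\})$, and for every $M$ there exists $K>0$, with $K$ independent of $s,t,T,N$, of the probability space and of $\boldsymbol x$, and $\lambda_2,\lambda_3$ moreover independent of $M$, such that the following holds. For all $N$, all $T\ge s\ge t\ge0$ with $s-t<1$, all $\mathcal F_t$-measurable $\boldsymbol x$ whose components $x_i\in L^4$ are identically distributed with $\mathbb E|x_i|^4\le M$, and all $j\in\{1,\dots,N\}$, the differences $X^{t,i}_{T,x_j}-X^{s,i}_{T,x_j}$ (both processes started from the same $\boldsymbol x$, at times $t$ and $s$ respectively) are square integrable and $$\sum_{i=1}^N\mathbb E\big[|X^{t,i}_{T,x_j}-X^{s,i}_{T,x_j}|^2\big]\le K(s-t)e^{-2\lambda_2(T-s)},$$ $$\sum_{i=1,\,i\ne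 j}^N\mathbb E\big[|X^{t,i}_{T,x_j}-X^{s,i}_{T,x_j}|^2\big]\le \frac{K(s-t)}{N}e^{-2\lambda_3(T-s)}.$$ -/

import Mathlib

open MeasureTheory ProbabilityTheory
open scoped NNReal

/-- Standing assumptions on the confining potential `U` and the interaction potential `V`, with
uniform convexity constant `lam` of `U` and bound `KV` on the second derivative of `V`. The gradients
are `deriv U` and `deriv V`; their derivatives up to order six are the derivatives of `U` and `V` of
orders two to seven. -/
structure PotentialAssumption (U V : ℝ → ℝ) (lam KV : ℝ) : Prop where
  contDiff_U : ContDiff ℝ 7 U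
  contDiff_V : ContDiff ℝ 7 V
  lam_pos : 0 < lam
  KV_pos : 0 < KV
  uniformly_convex_U : ∀ x y : ℝ, lam * |x - y| ^ 2 ≤ (deriv U x - deriv U y) * (x - y)
  even_V : ∀ x : ℝ, V (-x) = V x
  convex_V : ∀ x y : ℝ, 0 ≤ (deriv V x - deriv V y) * (x - y)
  hessian_V_le : ∀ x : ℝ, |iteratedDeriv 2 V x| ≤ KV
  bounded_derivs_U : ∀ k : ℕ, 2 ≤ k → k ≤ 7 → ∃ C : ℝ, ∀ x : ℝ, |iteratedDeriv k U x| ≤ C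
  bounded_derivs_V : ∀ k : ℕ, 2 ≤ k → k ≤ 7 → ∃ C : ℝ, ∀ x : ℝ, |iteratedDeriv k V x| ≤ C
  seven_mul_KV_le : 7 * KV ≤ lam

/-- The `i`-th component `B_i(x) = - U'(x_i) - (1/N) ∑_j V'(x_i - x_j)` of the drift of the
interacting particle system. -/
noncomputable def drift (U V : ℝ → ℝ) {N : ℕ} (i : Fin N) (x : Fin N → ℝ) : ℝ :=
  -deriv U (x i) - (1 / (N : ℝ)) * ∑ j, deriv V (x i - x j)

/-- The partial derivative of `f : ℝ^N → ℝ` in the `l`-th coordinate. -/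
noncomputable def partialDeriv {N : ℕ} (l : Fin N) (f : (Fin N → ℝ) → ℝ) (x : Fin N → ℝ) : ℝ :=
  fderiv ℝ f x (Pi.single l 1)

/-- `W = (W^1, …, W^N)` is an `N`-dimensional standard Brownian motion relative to the filtration
`ℱ`: its components are independent real Brownian motions adapted to `ℱ`, and the increments of `W`
after time `s` are independent of `ℱ s`. -/
structure IsFilteredBrownian {Ω : Type*} {m : MeasurableSpace Ω} (P : Measure Ω)
    (ℱ : Filtration ℝ≥0 m) {N : ℕ} (W : Fin N → ℝ≥0 → Ω → ℝ) : Prop where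
  brownian : ∀ i, IsBrownianReal (W i) P
  iIndep : iIndepFun (fun i ω (t : ℝ≥0) => W i t ω) P
  adapted : ∀ i, Adapted ℱ (W i)
  indep_increments : ∀ s t : ℝ≥0, s ≤ t →
    Indep (MeasurableSpace.comap (fun ω (i : Fin N) => W i t ω - W i s ω) inferInstance) (ℱ s) P

/-- `X` is the interacting particle system started at time `t` in the random point `ξ`: a continuous
adapted process on `[t, ∞)` with
`X_s^i = ξ^i + ∫_t^s B_i(X_u) du + σ (W^i_s - W^i_t)` for all `s ≥ t`. -/
structure IsParticleFlow {Ω : Type*} {m : MeasurableSpace Ω} (P : Measure Ω)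
    (ℱ : Filtration ℝ≥0 m) (U V : ℝ → ℝ) (σ : ℝ) {N : ℕ} (W : Fin N → ℝ≥0 → Ω → ℝ)
    (t : ℝ≥0) (ξ : Ω → Fin N → ℝ) (X : ℝ≥0 → Ω → Fin N → ℝ) : Prop where
  adapted : ∀ s, t ≤ s → Measurable[ℱ s] (X s)
  continuousOn : ∀ᵐ ω ∂P, ContinuousOn (fun s => X s ω) (Set.Ici t)
  equation : ∀ᵐ ω ∂P, ∀ s, t ≤ s → ∀ i,
    X s ω i = ξ ω i + (∫ u in (t : ℝ)..(s : ℝ), drift U V i (X u.toNNReal ω))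
      + σ * (W i s ω - W i t ω)

/-- `J` is the first variation process of the particle flow `X` started at time `t`; the entry
`J s ω i j` is the variation of the `i`-th particle at time `s` in the `j`-th starting point. It is
a continuous adapted process on `[t, ∞)` with
`J_s^{i,j} = δ_{i,j} + ∫_t^s ∑_l ∂_{x_l} B_i(X_u) J_u^{l,j} du` for all `s ≥ t`. -/
structure IsFirstVariation {Ω : Type*} {m : MeasurableSpace Ω} (P : Measure Ω)
    (ℱ : Filtration ℝ≥0 m) (U V : ℝ → ℝ) {N : ℕ} (t : ℝ≥0)
    (X : ℝ≥0 → Ω → Fin N → ℝ) (J : ℝ≥0 → Ω → Fin N → Fin N → ℝ) : Prop where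
  adapted : ∀ s, t ≤ s → Measurable[ℱ s] (J s)
  continuousOn : ∀ᵐ ω ∂P, ContinuousOn (fun s => J s ω) (Set.Ici t)
  equation : ∀ᵐ ω ∂P, ∀ s, t ≤ s → ∀ i j,
    J s ω i j = (if i = j then 1 else 0)
      + ∫ u in (t : ℝ)..(s : ℝ),
          ∑ l, partialDeriv l (drift U V i) (X u.toNNReal ω) * J u.toNNReal ω l j

/-! The estimates are pathwise until the last step. Put ν = `lam - 2 * KV`. The difference of the
two flows, a column of the first variation, the difference of two such columns and the displacement
from a freely moving Brownian path all satisfy v_i v_i' ≤ -`lam` v_i² + |v_i| (`KV` avg|v| +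
forcing). Here the convexity of `U` supplies `lam`, the convexity of `V` makes the diagonal part of
the interaction harmless, and only the cross terms cost `KV` times an average.
`abs_le_of_meanField_dissipative` turns this into decay at rate ν, component by component, with
amplitude b_i + avg b. Working by components rather than in a norm preserves the profile δ_ij + 1/N
(`weight`) of the first variation, and this profile is the source of the factor 1/N off the
diagonal.

For the difference of the two first variations (`abs_firstVariation_sub_le`) there are two sources.
At time s the older one has moved away from the identity by O(s - t) times the weight. Afterwards
the linearised drifts are evaluated along different paths; the resulting forcing is a product of the
distance of the flows and the size of the first variation, each decaying like exp(-ν(r - s)). One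
factor gives the decay, the other is integrable in time and costs 1/ν. The distance of the flows is
governed by the displacement X_s - ξ during [t, s], because the common noise cancels after time s.

Probability enters only through that displacement: by `IsParticleFlow.integral_sq_displacement_le`
its mean square is O(s - t), from the Brownian increments and the moments of ξ. Squaring,
integrating and summing the squared weights, which give O(1) in total and at most 1/N off the
diagonal, yields both bounds with the factor exp(-2ν(T - s)), hence with any smaller rates. -/

/-! ### Comparison by first exit -/

/-- A finite family of functions which starts out nonpositive, and of which no member can increase
through zero while all the others are nonpositive, stays nonpositive. -/
theorem nonpos_of_deriv_neg_at_first_exit {ι : Type*} [Finite ι] {a b : ℝ} {h h' : ℝ → ι → ℝ}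
    (hab : a ≤ b) (hcont : ∀ i, ContinuousOn (fun u => h u i) (Set.Icc a b))
    (hderiv : ∀ i, ∀ u ∈ Set.Ico a b, HasDerivWithinAt (fun u => h u i) (h' u i) (Set.Ici u) u)
    (hneg : ∀ u ∈ Set.Ico a b, (∀ k, h u k ≤ 0) → ∀ i, h u i = 0 → h' u i < 0)
    (ha : ∀ i, h a i ≤ 0) (i : ι) : h b i ≤ 0 := by
  have hclosed : IsClosed ({u | ∀ i, h u i ≤ 0} ∩ Set.Icc a b) := by
    have : {u | ∀ i, h u i ≤ 0} ∩ Set.Icc a b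
        = Set.Icc a b ∩ (fun u => h u) ⁻¹' (Set.Iic 0) := by
      ext u; simp [and_comm, Pi.le_def]
    rw [this]
    exact (continuousOn_pi.2 hcont).preimage_isClosed_of_isClosed isClosed_Icc isClosed_Iic
  -- Continuous induction: it remains to continue the inequalities a little to the right of any
  -- point where they hold.
  have hsub := hclosed.Icc_subset_of_forall_exists_gt (a := a) (b := b) ha ?_
  · exact hsub (Set.right_mem_Icc.2 hab) i
  rintro x ⟨hx, hxab⟩ y hy
  have key : ∀ᶠ u in nhdsWithin x (Set.Ioi x), ∀ i, h u i ≤ 0 := by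
    rw [Filter.eventually_all]
    intro i
    have hd := hderiv i x hxab
    rcases (hx i).lt_or_eq with hlt | heq
    · have hc : Filter.Tendsto (fun u => h u i) (nhdsWithin x (Set.Ioi x)) (nhds (h x i)) :=
        hd.continuousWithinAt.mono_left (nhdsWithin_mono _ Set.Ioi_subset_Ici_self)
      exact (hc.eventually (gt_mem_nhds hlt)).mono fun u hu => hu.le
    · have hs := (hasDerivWithinAt_iff_tendsto_slope' Set.self_notMem_Ioi).1
        (hd.mono Set.Ioi_subset_Ici_self)
      filter_upwards [hs.eventually (gt_mem_nhds (hneg x hxab hx i heq)), self_mem_nhdsWithin]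
        with u hu hxu
      rw [slope_def_field, heq, sub_zero, div_neg_iff] at hu
      have : 0 < u - x := sub_pos.2 hxu
      rcases hu with h1 | h1 <;> linarith [h1.1, h1.2]
  have hmem : ∀ᶠ u in nhdsWithin x (Set.Ioi x), u ∈ Set.Ioc x y := Ioc_mem_nhdsGT hy
  exact (key.and hmem).exists.imp fun u hu => hu

/-! ### Averages over the particles -/

/-- The average of a finite family. -/
noncomputable def avg {N : ℕ} (f : Fin N → ℝ) : ℝ := (1 / (N : ℝ)) * ∑ k, f k

section avg
variable {N : ℕ}

theorem avg_nonneg {f : Fin N → ℝ} (hf : ∀ k, 0 ≤ f k) : 0 ≤ avg f :=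
  mul_nonneg (by positivity) (Finset.sum_nonneg fun k _ => hf k)

theorem avg_mono {f g : Fin N → ℝ} (h : ∀ k, f k ≤ g k) : avg f ≤ avg g :=
  mul_le_mul_of_nonneg_left (Finset.sum_le_sum fun k _ => h k) (by positivity)

theorem avg_add (f g : Fin N → ℝ) : avg (fun k => f k + g k) = avg f + avg g := by
  simp [avg, Finset.sum_add_distrib, mul_add]

theorem avg_sub (f g : Fin N → ℝ) : avg (fun k => f k - g k) = avg f - avg g := by
  simp [avg, Finset.sum_sub_distrib, mul_sub]

theorem avg_mul_left (c : ℝ) (f : Fin N → ℝ) : avg (fun k => c * f k) = c * avg f := by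
  simp only [avg, ← Finset.mul_sum]; ring

theorem avg_const [NeZero N] (c : ℝ) : avg (fun _ : Fin N => c) = c := by
  have : (N : ℝ) ≠ 0 := Nat.cast_ne_zero.2 (NeZero.ne N)
  simp [avg, this]

theorem abs_avg_le (f : Fin N → ℝ) : |avg f| ≤ avg fun k => |f k| := by
  rw [avg, avg, abs_mul, abs_of_nonneg (by positivity : (0 : ℝ) ≤ 1 / N)]
  exact mul_le_mul_of_nonneg_left (Finset.abs_sum_le_sum_abs _ _) (by positivity)

/-- The difference of the two sides is the empirical variance. -/
theorem avg_sq_le [NeZero N] (f : Fin N → ℝ) : avg f ^ 2 ≤ avg fun k => f k ^ 2 := by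
  have h : 0 ≤ avg fun k => (f k - avg f) ^ 2 := avg_nonneg fun k => sq_nonneg _
  have h2 : (avg fun k => (f k - avg f) ^ 2)
      = avg (fun k => f k ^ 2) - avg f ^ 2 := by
    have : (fun k => (f k - avg f) ^ 2)
        = fun k => (f k ^ 2 - 2 * avg f * f k) + avg f ^ 2 := by ext k; ring
    rw [this, avg_add (fun k => f k ^ 2 - 2 * avg f * f k) fun _ => avg f ^ 2,
      avg_sub (fun k => f k ^ 2) fun k => 2 * avg f * f k, avg_mul_left, avg_const]
    ring
  linarith

theorem HasDerivWithinAt.avg {g : ℝ → Fin N → ℝ} {g' : Fin N → ℝ} {S : Set ℝ} {u : ℝ}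
    (h : ∀ k, HasDerivWithinAt (fun r => g r k) (g' k) S u) :
    HasDerivWithinAt (fun r => avg (g r)) (avg g') S u :=
  (HasDerivWithinAt.fun_sum fun k _ => h k).const_mul _

theorem ContinuousOn.avg {g : ℝ → Fin N → ℝ} {S : Set ℝ}
    (h : ∀ k, ContinuousOn (fun r => g r k) S) : ContinuousOn (fun r => avg (g r)) S :=
  continuousOn_const.mul (continuousOn_finsetSum _ fun k _ => h k)

end avg

/-! ### Dissipative systems with mean-field coupling -/

/-- Componentwise comparison for a dissipative system with mean-field coupling: decay at rate
`lam - 2 * KV`, with `b'` the forcing measured relative to that rate. -/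
theorem abs_le_of_meanField_dissipative {N : ℕ} [NeZero N] {lam KV s T : ℝ} (hKV : 0 < KV)
    (hsT : s ≤ T) {v v' b b' : ℝ → Fin N → ℝ}
    (hvc : ∀ i, ContinuousOn (fun u => v u i) (Set.Icc s T))
    (hv : ∀ i, ∀ u ∈ Set.Ico s T, HasDerivWithinAt (fun u => v u i) (v' u i) (Set.Ici u) u)
    (hbc : ∀ i, ContinuousOn (fun u => b u i) (Set.Icc s T))
    (hb : ∀ i, ∀ u ∈ Set.Ico s T, HasDerivWithinAt (fun u => b u i) (b' u i) (Set.Ici u) u)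
    (hb0 : ∀ i, ∀ u ∈ Set.Icc s T, 0 ≤ b u i) (hb'0 : ∀ i, ∀ u ∈ Set.Ico s T, 0 ≤ b' u i)
    (hdiss : ∀ i, ∀ u ∈ Set.Ico s T, v u i * v' u i ≤ -lam * v u i ^ 2
      + |v u i| * (KV * avg (fun k => |v u k|) + Real.exp (-(lam - 2 * KV) * (u - s)) * b' u i))
    (h0 : ∀ i, |v s i| ≤ b s i) (i : Fin N) :
    |v T i| ≤ Real.exp (-(lam - 2 * KV) * (T - s)) * (b T i + avg (b T)) := by
  set ν := lam - 2 * KV with hν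
  have main : ∀ ε : ℝ, 0 < ε →
      |v T i| ≤ Real.exp (-ν * (T - s)) * (b T i + avg (b T) + ε) := by
    intro ε hε
    -- The barrier. Adding `avg (b u)` to each component absorbs the coupling, and `ε` makes the
    -- crossing inequality strict.
    set ψ : ℝ → Fin N → ℝ := fun u i => Real.exp (-ν * (u - s)) * (b u i + avg (b u) + ε) with hψ
    set ψ' : ℝ → Fin N → ℝ := fun u i => -ν * ψ u i
      + Real.exp (-ν * (u - s)) * (b' u i + avg (b' u)) with hψ'
    have hψpos : ∀ u ∈ Set.Icc s T, ∀ i, 0 < ψ u i := fun u hu i =>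
      mul_pos (Real.exp_pos _)
        (by linarith [hb0 i u hu, avg_nonneg fun k => hb0 k u hu])
    have hψd : ∀ i, ∀ u ∈ Set.Ico s T,
        HasDerivWithinAt (fun u => ψ u i) (ψ' u i) (Set.Ici u) u := by
      intro i u hu
      have h1 : HasDerivWithinAt (fun u => Real.exp (-ν * (u - s)))
          (Real.exp (-ν * (u - s)) * (-ν * 1)) (Set.Ici u) u :=
        ((((hasDerivAt_id u).sub_const s).const_mul (-ν)).exp).hasDerivWithinAt
      have h2 := h1.mul (((hb i u hu).add (HasDerivWithinAt.avg fun k => hb k u hu)).add_const ε)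
      refine h2.congr_deriv ?_
      simp only [hψ', hψ, Pi.add_apply]
      ring
    have hψc : ∀ i, ContinuousOn (fun u => ψ u i) (Set.Icc s T) := fun i =>
      (by fun_prop : Continuous fun u => Real.exp (-ν * (u - s))).continuousOn.mul
        (((hbc i).add (ContinuousOn.avg hbc)).add continuousOn_const)
    -- Squares are compared because `|v|` need not be differentiable where it vanishes.
    have hexit : v T i ^ 2 - ψ T i ^ 2 ≤ 0 := by
      refine nonpos_of_deriv_neg_at_first_exit (h := fun u i => v u i ^ 2 - ψ u i ^ 2)
        (h' := fun u i => 2 * (v u i * v' u i) - 2 * (ψ u i * ψ' u i)) hsT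
        (fun i => ((hvc i).pow 2).sub ((hψc i).pow 2)) ?_ ?_ ?_ i
      · intro i u hu
        refine (((hv i u hu).fun_pow 2).sub ((hψd i u hu).fun_pow 2)).congr_deriv ?_
        simp; ring
      · intro u hu hle i hi
        have huc : u ∈ Set.Icc s T := ⟨hu.1, hu.2.le⟩
        have habs : ∀ k, |v u k| ≤ ψ u k := fun k =>
          abs_le_of_sq_le_sq (by linarith [hle k]) (hψpos u huc k).le
        have heq : |v u i| = ψ u i := by
          rw [← abs_of_pos (hψpos u huc i)]
          exact (sq_eq_sq_iff_abs_eq_abs _ _).1 (by linarith)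
        have hd := hdiss i u hu
        have hp := hψpos u huc i
        have hE := Real.exp_pos (-ν * (u - s))
        have hav : avg (fun k => |v u k|) ≤ Real.exp (-ν * (u - s)) * (2 * avg (b u) + ε) := by
          refine (avg_mono habs).trans_eq ?_
          rw [avg_mul_left, avg_add (fun k => b u k + avg (b u)) fun _ => ε,
            avg_add (b u) fun _ => avg (b u), avg_const, avg_const]
          ring
        have hb'a : 0 ≤ avg (b' u) := avg_nonneg fun k => hb'0 k u hu
        rw [← sq_abs (v u i), heq] at hd
        have hstrict : -lam * ψ u i
            + (KV * avg (fun k => |v u k|) + Real.exp (-ν * (u - s)) * b' u i) < ψ' u i := by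
          -- Averaging the barrier doubles `avg (b u)`, while each `ψ u i` contains it once. This
          -- factor 2 is what lowers the rate from `lam` to `lam - 2 * KV`.
          have h1 : KV * avg (fun k => |v u k|) < 2 * KV * ψ u i := by
            calc _ ≤ KV * (Real.exp (-ν * (u - s)) * (2 * avg (b u) + ε)) :=
                  mul_le_mul_of_nonneg_left hav hKV.le
              _ < KV * (2 * ψ u i) := by
                  refine mul_lt_mul_of_pos_left ?_ hKV
                  simp only [hψ]
                  have := mul_pos hE hε
                  have := mul_nonneg hE.le (hb0 i u huc)
                  nlinarith
              _ = _ := by ring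
          have h2 : 0 ≤ Real.exp (-ν * (u - s)) * avg (b' u) := mul_nonneg hE.le hb'a
          simp only [hψ', mul_add]
          simp only [hν] at *
          nlinarith
        have := mul_lt_mul_of_pos_left hstrict hp
        nlinarith
      · intro i
        have hss : s ∈ Set.Icc s T := ⟨le_rfl, hsT⟩
        have h2 : |v s i| ≤ ψ s i := by
          simp only [hψ, sub_self, mul_zero, Real.exp_zero, one_mul]
          linarith [h0 i, avg_nonneg fun k => hb0 k s hss]
        have := sq_abs (v s i) ▸ pow_le_pow_left₀ (abs_nonneg _) h2 2
        simpa using this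
    exact abs_le_of_sq_le_sq (by linarith) (hψpos T ⟨hsT, le_rfl⟩ i).le
  refine le_of_forall_pos_le_add fun δ hδ => ?_
  have hE := Real.exp_pos (-ν * (T - s))
  have := main (δ / Real.exp (-ν * (T - s))) (by positivity)
  rwa [mul_add _ _ (δ / _), mul_div_cancel₀ _ hE.ne'] at this

/-! ### Consequences of the assumptions on the potentials -/

namespace PotentialAssumption
variable {U V : ℝ → ℝ} {lam KV : ℝ}

theorem contDiff_deriv_of_contDiff_succ {f : ℝ → ℝ} {n k : ℕ} (hk : k = n + 1)
    (hf : ContDiff ℝ k f) : ContDiff ℝ n (deriv f) := by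
  subst hk
  rw [Nat.cast_add, Nat.cast_one] at hf
  exact (contDiff_succ_iff_deriv.1 hf).2.2

theorem contDiff_deriv_U (h : PotentialAssumption U V lam KV) : ContDiff ℝ 6 (deriv U) :=
  contDiff_deriv_of_contDiff_succ (n := 6) (k := 7) rfl h.contDiff_U

theorem contDiff_deriv_V (h : PotentialAssumption U V lam KV) : ContDiff ℝ 6 (deriv V) :=
  contDiff_deriv_of_contDiff_succ (n := 6) (k := 7) rfl h.contDiff_V

theorem contDiff_deriv_deriv_U (h : PotentialAssumption U V lam KV) :
    ContDiff ℝ 5 (deriv (deriv U)) :=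
  contDiff_deriv_of_contDiff_succ (n := 5) (k := 6) rfl h.contDiff_deriv_U

theorem contDiff_deriv_deriv_V (h : PotentialAssumption U V lam KV) :
    ContDiff ℝ 5 (deriv (deriv V)) :=
  contDiff_deriv_of_contDiff_succ (n := 5) (k := 6) rfl h.contDiff_deriv_V

theorem le_deriv_deriv_of_strongMono {f : ℝ → ℝ} {c : ℝ} (hf : Differentiable ℝ f)
    (h : ∀ x y, c * |x - y| ^ 2 ≤ (f x - f y) * (x - y)) (x : ℝ) : c ≤ deriv f x := by
  have ht := hasDerivAt_iff_tendsto_slope.1 (hf x).hasDerivAt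
  refine ge_of_tendsto ht ?_
  filter_upwards [self_mem_nhdsWithin] with y hy
  have hxy : y - x ≠ 0 := sub_ne_zero.2 hy
  rw [slope_def_field]
  have hsq : 0 < (y - x) ^ 2 := by positivity
  have := h y x
  rw [sq_abs] at this
  rw [show (f y - f x) / (y - x) = (f y - f x) * (y - x) / (y - x) ^ 2 by field_simp,
    le_div_iff₀ hsq]
  exact this

theorem le_hessian_U (h : PotentialAssumption U V lam KV) (x : ℝ) : lam ≤ deriv (deriv U) x :=
  le_deriv_deriv_of_strongMono (h.contDiff_deriv_U.differentiable (by norm_num))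
    h.uniformly_convex_U x

theorem hessian_V_nonneg (h : PotentialAssumption U V lam KV) (x : ℝ) :
    0 ≤ deriv (deriv V) x :=
  le_deriv_deriv_of_strongMono (h.contDiff_deriv_V.differentiable (by norm_num))
    (fun x y => by simpa using h.convex_V x y) x

theorem abs_sub_le_of_abs_deriv_le {f : ℝ → ℝ} {c : ℝ} (hf : Differentiable ℝ f)
    (h : ∀ x, |deriv f x| ≤ c) (x y : ℝ) : |f x - f y| ≤ c * |x - y| :=
  convex_univ.norm_image_sub_le_of_norm_deriv_le (fun z _ => hf z) (fun z _ => h z)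
    (Set.mem_univ y) (Set.mem_univ x)

theorem abs_hessian_V_le (h : PotentialAssumption U V lam KV) (x : ℝ) :
    |deriv (deriv V) x| ≤ KV := by
  simpa [iteratedDeriv_succ] using h.hessian_V_le x

theorem abs_deriv_V_sub_le (h : PotentialAssumption U V lam KV) (x y : ℝ) :
    |deriv V x - deriv V y| ≤ KV * |x - y| :=
  abs_sub_le_of_abs_deriv_le (h.contDiff_deriv_V.differentiable (by norm_num))
    h.abs_hessian_V_le x y

/-- The derivative of an even function is odd. With the Lipschitz bound this gives linear growth of
`deriv V` without an additive constant. -/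
theorem deriv_V_zero (h : PotentialAssumption U V lam KV) : deriv V 0 = 0 := by
  have h1 : deriv (fun x => V (-x)) 0 = deriv V 0 := by simp only [h.even_V]
  rw [deriv_comp_neg, neg_zero] at h1
  linarith

/-- All the bounds on `U` and `V` besides the convexity constants, gathered in one constant. -/
theorem exists_common_bound (h : PotentialAssumption U V lam KV) :
    ∃ C : ℝ, 0 < C ∧ KV ≤ C ∧ |deriv U 0| ≤ C ∧ (∀ x, |deriv (deriv U) x| ≤ C) ∧
      (∀ x y, |deriv (deriv U) x - deriv (deriv U) y| ≤ C * |x - y|) ∧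
      (∀ x y, |deriv (deriv V) x - deriv (deriv V) y| ≤ C * |x - y|) := by
  obtain ⟨A, hA⟩ := h.bounded_derivs_U 2 (by norm_num) (by norm_num)
  obtain ⟨B, hB⟩ := h.bounded_derivs_U 3 (by norm_num) (by norm_num)
  obtain ⟨D, hD⟩ := h.bounded_derivs_V 3 (by norm_num) (by norm_num)
  simp only [iteratedDeriv_succ, iteratedDeriv_zero] at hA hB hD
  have hA0 := (abs_nonneg _).trans (hA 0)
  have hB0 := (abs_nonneg _).trans (hB 0)
  have hD0 := (abs_nonneg _).trans (hD 0)
  have hK := h.KV_pos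
  have hU0 := abs_nonneg (deriv U 0)
  refine ⟨KV + |deriv U 0| + A + B + D, by linarith, by linarith, by linarith,
    fun x => (hA x).trans (by linarith), ?_, ?_⟩
  · exact abs_sub_le_of_abs_deriv_le (h.contDiff_deriv_deriv_U.differentiable (by norm_num))
      fun x => (hB x).trans (by linarith)
  · exact abs_sub_le_of_abs_deriv_le (h.contDiff_deriv_deriv_V.differentiable (by norm_num))
      fun x => (hD x).trans (by linarith)

end PotentialAssumption

/-! ### The drift and its linearisation -/

/-- The derivative of `drift U V i` at `x` in the direction `v`. -/
noncomputable def linDrift (U V : ℝ → ℝ) {N : ℕ} (i : Fin N) (x v : Fin N → ℝ) : ℝ :=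
  -deriv (deriv U) (x i) * v i - avg fun k => deriv (deriv V) (x i - x k) * (v i - v k)

section drift
variable {U V : ℝ → ℝ} {lam KV C : ℝ} {N : ℕ}

theorem drift_eq_avg (i : Fin N) (x : Fin N → ℝ) :
    drift U V i x = -deriv U (x i) - avg fun k => deriv V (x i - x k) := rfl

/-- Replaces the coordinate form of the variation equation by one in the differences `v i - v k`,
where the dissipation is visible. -/
theorem sum_partialDeriv_drift_mul (h : PotentialAssumption U V lam KV) (i : Fin N)
    (x v : Fin N → ℝ) :
    ∑ l, partialDeriv l (drift U V i) x * v l = linDrift U V i x v := by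
  have hU : Differentiable ℝ (deriv U) := h.contDiff_deriv_U.differentiable (by norm_num)
  have hV : Differentiable ℝ (deriv V) := h.contDiff_deriv_V.differentiable (by norm_num)
  have hp : ∀ k, HasFDerivAt (fun y : Fin N → ℝ => y k)
      (ContinuousLinearMap.proj (R := ℝ) (φ := fun _ : Fin N => ℝ) k) x :=
    fun k => hasFDerivAt_apply k x
  have h1 := (((hU (x i)).hasDerivAt.comp_hasFDerivAt x (hp i)).neg).sub
    ((HasFDerivAt.fun_sum (u := Finset.univ) fun k _ =>
      (hV (x i - x k)).hasDerivAt.comp_hasFDerivAt x ((hp i).sub (hp k))).const_mul (1 / (N : ℝ)))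
  have h2 : fderiv ℝ (drift U V i) x = _ := HasFDerivAt.fderiv h1
  have h3 : ∑ l, partialDeriv l (drift U V i) x * v l = fderiv ℝ (drift U V i) x v := by
    conv_rhs => rw [pi_eq_sum_univ' v, map_sum]
    refine Finset.sum_congr rfl fun l _ => ?_
    rw [map_smul, smul_eq_mul, mul_comm, partialDeriv]
  rw [h3, h2]
  simp [linDrift, avg]

/-- The interaction is split at V'(y_i - x_k): changing the first particle gives a term of good sign
since `V` is convex, changing the second costs `KV * |x k - y k|`. -/
theorem sub_mul_drift_sub_le (h : PotentialAssumption U V lam KV) (i : Fin N)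
    (x y : Fin N → ℝ) :
    (x i - y i) * (drift U V i x - drift U V i y)
      ≤ -lam * (x i - y i) ^ 2 + |x i - y i| * (KV * avg fun k => |x k - y k|) := by
  have h1 := h.uniformly_convex_U (x i) (y i)
  rw [sq_abs] at h1
  have h2 : avg (fun k => -(x i - y i) * (deriv V (x i - x k) - deriv V (y i - y k)))
      ≤ avg fun k => |x i - y i| * KV * |x k - y k| := by
    refine avg_mono fun k => ?_
    have h3 := h.convex_V (x i - x k) (y i - x k)
    have h4 := h.abs_deriv_V_sub_le (y i - x k) (y i - y k)
    have h5 : -(x i - y i) * (deriv V (y i - x k) - deriv V (y i - y k))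
        ≤ |x i - y i| * (KV * |x k - y k|) := by
      refine (le_abs_self _).trans ?_
      rw [abs_mul, abs_neg]
      refine mul_le_mul_of_nonneg_left (h4.trans_eq ?_) (abs_nonneg _)
      rw [sub_sub_sub_cancel_left, abs_sub_comm]
    rw [sub_sub_sub_cancel_right] at h3
    linarith
  rw [avg_mul_left, avg_mul_left, avg_sub] at h2
  rw [drift_eq_avg, drift_eq_avg]
  linarith

theorem abs_drift_le (h : PotentialAssumption U V lam KV) (hKC : KV ≤ C) (hU0 : |deriv U 0| ≤ C)
    (hU2 : ∀ x, |deriv (deriv U) x| ≤ C) (i : Fin N) (x : Fin N → ℝ) :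
    |drift U V i x| ≤ C * (1 + 2 * |x i| + avg fun k => |x k|) := by
  have : NeZero N := ⟨fun h0 => by subst h0; exact i.elim0⟩
  have hU := PotentialAssumption.abs_sub_le_of_abs_deriv_le
    (h.contDiff_deriv_U.differentiable (by norm_num)) hU2 (x i) 0
  rw [sub_zero] at hU
  have h1 : |deriv U (x i)| ≤ C + C * |x i| := by
    have := abs_add_le (deriv U (x i) - deriv U 0) (deriv U 0)
    rw [sub_add_cancel] at this
    linarith
  have h2 : |avg fun k => deriv V (x i - x k)| ≤ C * |x i| + C * avg fun k => |x k| := by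
    refine (abs_avg_le _).trans ?_
    calc _ ≤ avg fun k => C * |x i| + C * |x k| := avg_mono fun k => by
          have h3 := h.abs_deriv_V_sub_le (x i - x k) 0
          rw [h.deriv_V_zero, sub_zero, sub_zero] at h3
          have h4 := abs_sub (x i) (x k)
          have h5 := mul_le_mul hKC h4 (abs_nonneg _) (h.KV_pos.le.trans hKC)
          linarith
      _ = _ := by rw [avg_add (fun _ => C * |x i|) fun k => C * |x k|, avg_const, avg_mul_left]
  rw [drift_eq_avg]
  have := abs_sub (-deriv U (x i)) (avg fun k => deriv V (x i - x k))
  rw [abs_neg] at this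
  linarith

/-- In V''·(v_i² - v_i v_k) the square has a good sign and only the cross term is paid for. -/
theorem mul_linDrift_le (h : PotentialAssumption U V lam KV) (i : Fin N) (x v : Fin N → ℝ) :
    v i * linDrift U V i x v ≤ -lam * v i ^ 2 + |v i| * (KV * avg fun k => |v k|) := by
  have h1 := mul_le_mul_of_nonneg_right (h.le_hessian_U (x i)) (sq_nonneg (v i))
  have h2 : avg (fun k => -v i * (deriv (deriv V) (x i - x k) * (v i - v k)))
      ≤ avg fun k => |v i| * KV * |v k| := by
    refine avg_mono fun k => ?_
    have h3 := h.hessian_V_nonneg (x i - x k)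
    have h4 := (le_abs_self _).trans (h.abs_hessian_V_le (x i - x k))
    have h5 : v i * v k ≤ |v i| * |v k| := (le_abs_self _).trans (abs_mul _ _).le
    have h6 := mul_le_mul_of_nonneg_left h5 h3
    have h7 := mul_le_mul_of_nonneg_right h4 (mul_nonneg (abs_nonneg (v i)) (abs_nonneg (v k)))
    have h8 := mul_nonneg h3 (sq_nonneg (v i))
    linarith
  rw [avg_mul_left, avg_mul_left] at h2
  rw [linDrift]
  linarith

theorem abs_linDrift_le (h : PotentialAssumption U V lam KV) (hKC : KV ≤ C)
    (hU2 : ∀ x, |deriv (deriv U) x| ≤ C) (i : Fin N) (x v : Fin N → ℝ) :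
    |linDrift U V i x v| ≤ C * (2 * |v i| + avg fun k => |v k|) := by
  have : NeZero N := ⟨fun h0 => by subst h0; exact i.elim0⟩
  have h2 : |avg fun k => deriv (deriv V) (x i - x k) * (v i - v k)|
      ≤ C * |v i| + C * avg fun k => |v k| := by
    refine (abs_avg_le _).trans ?_
    calc _ ≤ avg fun k => C * |v i| + C * |v k| := avg_mono fun k => by
          rw [abs_mul, ← mul_add]
          exact mul_le_mul ((h.abs_hessian_V_le _).trans hKC) (abs_sub _ _) (abs_nonneg _)
            (h.KV_pos.le.trans hKC)
      _ = _ := by rw [avg_add (fun _ => C * |v i|) fun k => C * |v k|, avg_const, avg_mul_left]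
  have h1 := mul_le_mul_of_nonneg_right (hU2 (x i)) (abs_nonneg (v i))
  have h3 := abs_sub (-deriv (deriv U) (x i) * v i)
    (avg fun k => deriv (deriv V) (x i - x k) * (v i - v k))
  rw [abs_mul, abs_neg] at h3
  rw [linDrift]
  linarith

theorem linDrift_sub (i : Fin N) (x v w : Fin N → ℝ) :
    linDrift U V i x (fun k => v k - w k) = linDrift U V i x v - linDrift U V i x w := by
  have : (fun k => deriv (deriv V) (x i - x k) * (v i - w i - (v k - w k)))
      = fun k => deriv (deriv V) (x i - x k) * (v i - v k)
        - deriv (deriv V) (x i - x k) * (w i - w k) := by ext k; ring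
  rw [linDrift, this, avg_sub, linDrift, linDrift]
  ring

/-- The bound is bilinear in the distance of the positions and the size of `v`; two decaying factors
will later meet in it. -/
theorem abs_linDrift_sub_le (hC : 0 < C)
    (hU3 : ∀ x y, |deriv (deriv U) x - deriv (deriv U) y| ≤ C * |x - y|)
    (hV3 : ∀ x y, |deriv (deriv V) x - deriv (deriv V) y| ≤ C * |x - y|)
    (i : Fin N) (x y v : Fin N → ℝ) :
    |linDrift U V i x v - linDrift U V i y v| ≤ C * (|x i - y i| * |v i|
      + avg fun k => (|x i - y i| + |x k - y k|) * (|v i| + |v k|)) := by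
  have h0 : linDrift U V i x v - linDrift U V i y v
      = -((deriv (deriv U) (x i) - deriv (deriv U) (y i)) * v i)
        - avg fun k => (deriv (deriv V) (x i - x k) - deriv (deriv V) (y i - y k))
          * (v i - v k) := by
    have : (fun k => (deriv (deriv V) (x i - x k) - deriv (deriv V) (y i - y k)) * (v i - v k))
        = fun k => deriv (deriv V) (x i - x k) * (v i - v k)
          - deriv (deriv V) (y i - y k) * (v i - v k) := by ext k; ring
    rw [linDrift, linDrift, this, avg_sub]
    ring
  have h1 := mul_le_mul_of_nonneg_right (hU3 (x i) (y i)) (abs_nonneg (v i))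
  have h2 : |avg fun k => (deriv (deriv V) (x i - x k) - deriv (deriv V) (y i - y k))
      * (v i - v k)| ≤ C * avg fun k => (|x i - y i| + |x k - y k|) * (|v i| + |v k|) := by
    refine (abs_avg_le _).trans ?_
    rw [← avg_mul_left]
    refine avg_mono fun k => ?_
    rw [abs_mul, ← mul_assoc]
    refine mul_le_mul ((hV3 _ _).trans (mul_le_mul_of_nonneg_left ?_ hC.le)) (abs_sub _ _)
      (abs_nonneg _) (by positivity)
    rw [sub_sub_sub_comm]
    exact abs_sub _ _
  rw [h0]
  refine (abs_sub _ _).trans ?_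
  rw [abs_neg, abs_mul]
  linarith

theorem continuous_drift (h : PotentialAssumption U V lam KV) (i : Fin N) :
    Continuous (drift U V i) := by
  have hU := h.contDiff_deriv_U.continuous
  have hV := h.contDiff_deriv_V.continuous
  unfold drift
  fun_prop

theorem continuous_linDrift (h : PotentialAssumption U V lam KV) (i : Fin N) :
    Continuous fun p : (Fin N → ℝ) × (Fin N → ℝ) => linDrift U V i p.1 p.2 := by
  have hU := h.contDiff_deriv_deriv_U.continuous
  have hV := h.contDiff_deriv_deriv_V.continuous
  unfold linDrift avg
  fun_prop

end drift

/-! ### From integral equations to right derivatives -/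

/-- A path given on `[t, ∞)` as the integral of a continuous function is right differentiable. -/
theorem hasDerivWithinAt_of_eq_integral {t : ℝ≥0} {g p : ℝ≥0 → ℝ} {c : ℝ}
    (hg : ContinuousOn g (Set.Ici t))
    (hp : ∀ s, t ≤ s → p s = c + ∫ u in (t : ℝ)..(s : ℝ), g u.toNNReal) {u : ℝ} (hu : (t : ℝ) ≤ u) :
    HasDerivWithinAt (fun r : ℝ => p r.toNNReal) (g u.toNNReal) (Set.Ici u) u := by
  -- Freezing `g` before time `t` makes the integrand continuous on the whole line, so that the
  -- fundamental theorem of calculus applies also at `t`.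
  have hG : Continuous fun r : ℝ => g (max t r.toNNReal) :=
    hg.comp_continuous (by fun_prop) fun r => Set.mem_Ici.2 (le_max_left _ _)
  have hmax : ∀ r : ℝ, (t : ℝ) ≤ r → max t r.toNNReal = r.toNNReal := fun r hr =>
    max_eq_right (NNReal.le_toNNReal_of_coe_le hr)
  have hd := ((intervalIntegral.integral_hasDerivAt_right (hG.intervalIntegrable (t : ℝ) u)
    hG.aestronglyMeasurable.stronglyMeasurableAtFilter hG.continuousAt).const_add c).hasDerivWithinAt
    (s := Set.Ici u)
  simp only [hmax u hu] at hd
  have heq : ∀ r ∈ Set.Ici u, p r.toNNReal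
      = c + ∫ a in (t : ℝ)..r, g (max t a.toNNReal) := by
    intro r hr
    have htr : (t : ℝ) ≤ r := hu.trans hr
    rw [hp _ (NNReal.le_toNNReal_of_coe_le htr), Real.coe_toNNReal r (t.coe_nonneg.trans htr)]
    congr 1
    refine intervalIntegral.integral_congr fun a ha => ?_
    rw [Set.uIcc_of_le htr] at ha
    simp only [hmax a ha.1]
  exact hd.congr heq (heq u Set.self_mem_Ici)

theorem continuousOn_comp_toNNReal {E : Type*} [TopologicalSpace E] {t : ℝ≥0} {p : ℝ≥0 → E}
    (hp : ContinuousOn p (Set.Ici t)) :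
    ContinuousOn (fun r : ℝ => p r.toNNReal) (Set.Ici (t : ℝ)) :=
  hp.comp (by fun_prop) fun _ hr => NNReal.le_toNNReal_of_coe_le hr

/-! ### The weight profile of the first variation -/

/-- Weights bounding the `j`-th column of the first variation: of order one on the diagonal and of
order `1 / N` off the diagonal. -/
noncomputable def weight {N : ℕ} (j i : Fin N) : ℝ := (if i = j then 1 else 0) + 1 / (N : ℝ)

section weight
variable {N : ℕ}

theorem avg_ite_mul (j : Fin N) (f : Fin N → ℝ) :
    avg (fun k => (if k = j then 1 else 0) * f k) = f j / N := by
  simp [avg]; ring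

theorem avg_ite (j : Fin N) : avg (fun k => if k = j then (1 : ℝ) else 0) = 1 / N := by
  simp [avg]

theorem avg_weight_mul (j : Fin N) (f : Fin N → ℝ) :
    avg (fun k => weight j k * f k) = (f j + avg f) / N := by
  simp only [weight, add_mul]
  rw [avg_add (fun k => (if k = j then 1 else 0) * f k) fun k => 1 / (N : ℝ) * f k, avg_ite_mul,
    avg_mul_left]
  ring

theorem avg_weight [NeZero N] (j : Fin N) : avg (weight j) = 2 / N := by
  have := avg_weight_mul j fun _ => 1
  simp only [mul_one, avg_const] at this
  rw [show avg (weight j) = avg (fun k => weight j k) from rfl, this]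
  norm_num

/-- With `avg_weight`, the average of the weights is at most twice any one of them, so mean-field
coupling respects the profile. -/
theorem one_div_le_weight (j i : Fin N) : 1 / (N : ℝ) ≤ weight j i := by
  rw [weight]; split_ifs <;> simp

theorem weight_nonneg (j i : Fin N) : 0 ≤ weight j i :=
  (by positivity : (0 : ℝ) ≤ 1 / N).trans (one_div_le_weight j i)

theorem sum_erase_weight_sq_le (j : Fin N) :
    ∑ i ∈ Finset.univ.erase j, weight j i ^ 2 ≤ 1 / N := by
  have hN : (0 : ℝ) < N := Nat.cast_pos.2 (Fin.pos j)
  have h1 : ∑ i ∈ Finset.univ.erase j, weight j i ^ 2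
      = ∑ i ∈ Finset.univ.erase j, (1 / (N : ℝ)) ^ 2 :=
    Finset.sum_congr rfl fun i hi => by simp [weight, Finset.ne_of_mem_erase hi]
  rw [h1]
  refine (Finset.sum_le_sum_of_subset_of_nonneg (Finset.subset_univ _)
    fun _ _ _ => by positivity).trans_eq ?_
  simp only [Finset.sum_const, Finset.card_univ, Fintype.card_fin, nsmul_eq_mul]
  field_simp

theorem sum_weight_sq_le (j : Fin N) : ∑ i, weight j i ^ 2 ≤ 5 := by
  have hN : (1 : ℝ) ≤ N := Nat.one_le_cast.2 (Fin.pos j)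
  have h1 : 1 / (N : ℝ) ≤ 1 := by rw [div_le_one₀ (by linarith)]; exact hN
  have h0 : 0 ≤ 1 / (N : ℝ) := by positivity
  rw [← Finset.add_sum_erase _ _ (Finset.mem_univ j)]
  have h2 := sum_erase_weight_sq_le j
  have h3 : weight j j ≤ 2 := by simp only [weight, if_true]; linarith
  have h4 := pow_le_pow_left₀ (weight_nonneg j j) h3 2
  linarith

end weight

/-! ### Pathwise estimates of the flow and its first variation -/

section paths
variable {U V : ℝ → ℝ} {lam KV C σ : ℝ} {N : ℕ} {t s : ℝ≥0} {ξ : Fin N → ℝ}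
  {w : Fin N → ℝ≥0 → ℝ} {x y : ℝ≥0 → Fin N → ℝ} {J J' : ℝ≥0 → Fin N → Fin N → ℝ}

/-- The noise is subtracted because only the remaining drift integral is differentiable in time. -/
theorem hasDerivWithinAt_flow (h : PotentialAssumption U V lam KV)
    (hxc : ContinuousOn x (Set.Ici t))
    (hx : ∀ u, t ≤ u → ∀ i, x u i = ξ i
      + (∫ r in (t : ℝ)..(u : ℝ), drift U V i (x r.toNNReal)) + σ * (w i u - w i t))
    (i : Fin N) {u : ℝ} (hu : (t : ℝ) ≤ u) :
    HasDerivWithinAt (fun r : ℝ => x r.toNNReal i - σ * (w i r.toNNReal - w i t))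
      (drift U V i (x u.toNNReal)) (Set.Ici u) u :=
  hasDerivWithinAt_of_eq_integral (g := fun r => drift U V i (x r))
    (p := fun r => x r i - σ * (w i r - w i t)) (c := ξ i)
    ((continuous_drift h i).comp_continuousOn hxc)
    (fun r hr => by simp only [hx r hr i]; ring) hu

theorem abs_flow_sub_le (h : PotentialAssumption U V lam KV) (hts : t ≤ s)
    (hxc : ContinuousOn x (Set.Ici t)) (hyc : ContinuousOn y (Set.Ici s))
    (hx : ∀ u, t ≤ u → ∀ i, x u i = ξ i
      + (∫ r in (t : ℝ)..(u : ℝ), drift U V i (x r.toNNReal)) + σ * (w i u - w i t))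
    (hy : ∀ u, s ≤ u → ∀ i, y u i = ξ i
      + (∫ r in (s : ℝ)..(u : ℝ), drift U V i (y r.toNNReal)) + σ * (w i u - w i s))
    {u : ℝ} (hu : (s : ℝ) ≤ u) (i : Fin N) :
    |x u.toNNReal i - y u.toNNReal i| ≤ Real.exp (-(lam - 2 * KV) * (u - s))
      * (|x s i - ξ i| + avg fun k => |x s k - ξ k|) := by
  have : NeZero N := ⟨fun h0 => by subst h0; exact i.elim0⟩
  have hts' : (t : ℝ) ≤ s := hts
  refine abs_le_of_meanField_dissipative (lam := lam) h.KV_pos hu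
    (v := fun r i => x r.toNNReal i - y r.toNNReal i)
    (v' := fun r i => drift U V i (x r.toNNReal) - drift U V i (y r.toNNReal))
    (b := fun _ i => |x s i - ξ i|) (b' := fun _ _ => 0) ?_ ?_ (fun _ => continuousOn_const)
    (fun _ _ _ => hasDerivWithinAt_const ..) (fun _ _ _ => abs_nonneg _) (fun _ _ _ => le_rfl)
    ?_ ?_ i
  · intro i
    have h1 := continuousOn_pi.1 ((continuousOn_comp_toNNReal hxc).mono
      (Set.Icc_subset_Ici_self.trans (Set.Ici_subset_Ici.2 hts') : Set.Icc (s : ℝ) u ⊆ _)) i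
    exact h1.sub (continuousOn_pi.1
      ((continuousOn_comp_toNNReal hyc).mono Set.Icc_subset_Ici_self) i)
  -- The noise terms counted from `t` and from `s` differ by a constant in time, so the noise drops
  -- out of the difference.
  · intro i r hr
    have h1 := ((hasDerivWithinAt_flow h hxc hx i (hts'.trans hr.1)).sub
      (hasDerivWithinAt_flow h hyc hy i hr.1)).add_const (σ * (w i s - w i t))
    refine h1.congr_of_eventuallyEq (Filter.Eventually.of_forall fun a => ?_) ?_
    · simp only [Pi.sub_apply]; ring
    · simp only [Pi.sub_apply]; ring
  · intro i r hr
    simpa using sub_mul_drift_sub_le h i (x r.toNNReal) (y r.toNNReal)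
  · intro i
    have : y s i = ξ i := by simpa using hy s le_rfl i
    simp [this]

theorem hasDerivWithinAt_firstVariation (h : PotentialAssumption U V lam KV)
    (hxc : ContinuousOn x (Set.Ici t)) (hJc : ContinuousOn J (Set.Ici t))
    (hJ : ∀ u, t ≤ u → ∀ i j, J u i j = (if i = j then 1 else 0)
      + ∫ r in (t : ℝ)..(u : ℝ),
        ∑ l, partialDeriv l (drift U V i) (x r.toNNReal) * J r.toNNReal l j)
    (i j : Fin N) {u : ℝ} (hu : (t : ℝ) ≤ u) :
    HasDerivWithinAt (fun r : ℝ => J r.toNNReal i j)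
      (linDrift U V i (x u.toNNReal) fun k => J u.toNNReal k j) (Set.Ici u) u := by
  refine hasDerivWithinAt_of_eq_integral
    (g := fun r => linDrift U V i (x r) fun k => J r k j)
    (p := fun r => J r i j) (c := if i = j then 1 else 0)
    ((continuous_linDrift h i).comp_continuousOn (hxc.prodMk (continuousOn_pi.2 fun k =>
      continuousOn_pi.1 (continuousOn_pi.1 hJc k) j))) (fun r hr => ?_) hu
  simp only [hJ r hr i j, sum_partialDeriv_drift_mul h]

/-- The comparison with no forcing and initial profile δ_ij, whose average is 1/N: the bound δ_ij +
avg δ is exactly `weight`. -/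
theorem abs_firstVariation_le (h : PotentialAssumption U V lam KV)
    (hxc : ContinuousOn x (Set.Ici t)) (hJc : ContinuousOn J (Set.Ici t))
    (hJ : ∀ u, t ≤ u → ∀ i j, J u i j = (if i = j then 1 else 0)
      + ∫ r in (t : ℝ)..(u : ℝ),
        ∑ l, partialDeriv l (drift U V i) (x r.toNNReal) * J r.toNNReal l j)
    {u : ℝ} (hu : (t : ℝ) ≤ u) (i j : Fin N) :
    |J u.toNNReal i j| ≤ Real.exp (-(lam - 2 * KV) * (u - t)) * weight j i := by
  have : NeZero N := ⟨fun h0 => by subst h0; exact i.elim0⟩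
  refine (abs_le_of_meanField_dissipative (lam := lam) h.KV_pos hu
    (v := fun r i => J r.toNNReal i j)
    (v' := fun r i => linDrift U V i (x r.toNNReal) fun k => J r.toNNReal k j)
    (b := fun _ i => if i = j then 1 else 0) (b' := fun _ _ => 0) ?_ ?_
    (fun _ => continuousOn_const) (fun _ _ _ => hasDerivWithinAt_const ..)
    (fun _ _ _ => by split_ifs <;> simp) (fun _ _ _ => le_rfl) ?_ ?_ i).trans_eq ?_
  · intro i
    exact continuousOn_pi.1 (continuousOn_pi.1
      ((continuousOn_comp_toNNReal hJc).mono Set.Icc_subset_Ici_self) i) j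
  · intro i r hr
    exact hasDerivWithinAt_firstVariation h hxc hJc hJ i j hr.1
  · intro i r hr
    simpa using mul_linDrift_le h i (x r.toNNReal) fun k => J r.toNNReal k j
  · intro i
    have := hJ t le_rfl i j
    simp only [intervalIntegral.integral_same, add_zero] at this
    simp only [Real.toNNReal_coe, this]
    split_ifs <;> simp
  · rw [weight, avg_ite]

/-- The variation equation has no noise term, so the first variation leaves the identity linearly in
time, with velocity bounded by the weights. -/
theorem abs_firstVariation_sub_ite_le (h : PotentialAssumption U V lam KV) (hKC : KV ≤ C)
    (hU2 : ∀ x, |deriv (deriv U) x| ≤ C) (hts : t ≤ s)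
    (hxc : ContinuousOn x (Set.Ici t)) (hJc : ContinuousOn J (Set.Ici t))
    (hJ : ∀ u, t ≤ u → ∀ i j, J u i j = (if i = j then 1 else 0)
      + ∫ r in (t : ℝ)..(u : ℝ),
        ∑ l, partialDeriv l (drift U V i) (x r.toNNReal) * J r.toNNReal l j)
    (i j : Fin N) :
    |J s i j - (if i = j then 1 else 0)| ≤ 4 * C * weight j i * ((s : ℝ) - t) := by
  have : NeZero N := ⟨fun h0 => by subst h0; exact i.elim0⟩
  have hts' : (t : ℝ) ≤ s := hts
  have hν : 0 ≤ lam - 2 * KV := by linarith [h.seven_mul_KV_le, h.KV_pos]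
  have hC : 0 ≤ C := h.KV_pos.le.trans hKC
  have hJw : ∀ r : ℝ, (t : ℝ) ≤ r → ∀ k, |J r.toNNReal k j| ≤ weight j k := fun r hr k =>
    (abs_firstVariation_le h hxc hJc hJ hr k j).trans
      (mul_le_of_le_one_left (weight_nonneg j k) (Real.exp_le_one_iff.2
        (by nlinarith [mul_nonneg hν (sub_nonneg.2 hr)])))
  rw [hJ s hts i j, add_sub_cancel_left]
  have h1 := intervalIntegral.norm_integral_le_of_norm_le_const (a := (t : ℝ)) (b := s)
    (C := 4 * C * weight j i) (f := fun r =>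
      ∑ l, partialDeriv l (drift U V i) (x r.toNNReal) * J r.toNNReal l j) ?_
  · rwa [abs_of_nonneg (sub_nonneg.2 hts')] at h1
  intro r hr
  rw [Set.uIoc_of_le hts'] at hr
  rw [sum_partialDeriv_drift_mul h i _ fun l => J r.toNNReal l j]
  refine (abs_linDrift_le h hKC hU2 i _ _).trans ?_
  have h2 : avg (fun k => |J r.toNNReal k j|) ≤ 2 * weight j i := by
    refine (avg_mono (hJw r hr.1.le)).trans ?_
    rw [show avg (fun k => weight j k) = 2 / N from avg_weight j]
    have := one_div_le_weight j i
    rw [show (2 : ℝ) / N = 2 * (1 / N) by ring]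
    linarith
  have := mul_le_mul_of_nonneg_left (add_le_add (mul_le_mul_of_nonneg_left
    (hJw r hr.1.le i) zero_le_two) h2) hC
  linarith

/-- Pathwise estimate of the difference of the first variations of two flows driven by the same
noise and started from the same point at times `t ≤ s`. -/
theorem abs_firstVariation_sub_le (h : PotentialAssumption U V lam KV) (hKC : KV ≤ C)
    (hU2 : ∀ x, |deriv (deriv U) x| ≤ C)
    (hU3 : ∀ x y, |deriv (deriv U) x - deriv (deriv U) y| ≤ C * |x - y|)
    (hV3 : ∀ x y, |deriv (deriv V) x - deriv (deriv V) y| ≤ C * |x - y|) (hts : t ≤ s)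
    (hxc : ContinuousOn x (Set.Ici t)) (hyc : ContinuousOn y (Set.Ici s))
    (hx : ∀ u, t ≤ u → ∀ i, x u i = ξ i
      + (∫ r in (t : ℝ)..(u : ℝ), drift U V i (x r.toNNReal)) + σ * (w i u - w i t))
    (hy : ∀ u, s ≤ u → ∀ i, y u i = ξ i
      + (∫ r in (s : ℝ)..(u : ℝ), drift U V i (y r.toNNReal)) + σ * (w i u - w i s))
    (hJc : ContinuousOn J (Set.Ici t)) (hJc' : ContinuousOn J' (Set.Ici s))
    (hJ : ∀ u, t ≤ u → ∀ i j, J u i j = (if i = j then 1 else 0)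
      + ∫ r in (t : ℝ)..(u : ℝ),
        ∑ l, partialDeriv l (drift U V i) (x r.toNNReal) * J r.toNNReal l j)
    (hJ' : ∀ u, s ≤ u → ∀ i j, J' u i j = (if i = j then 1 else 0)
      + ∫ r in (s : ℝ)..(u : ℝ),
        ∑ l, partialDeriv l (drift U V i) (y r.toNNReal) * J' r.toNNReal l j)
    {u : ℝ≥0} (hu : s ≤ u) (i j : Fin N) :
    |J u i j - J' u i j| ≤ Real.exp (-(lam - 2 * KV) * (u - s)) * (weight j i * (C
      * (12 * ((s : ℝ) - t) + (lam - 2 * KV)⁻¹ * (4 * |x s i - ξ i| + 4 * |x s j - ξ j|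
        + 26 * avg fun k => |x s k - ξ k|)))) := by
  have : NeZero N := ⟨fun h0 => by subst h0; exact i.elim0⟩
  have hts' : (t : ℝ) ≤ s := hts
  have hsu' : (s : ℝ) ≤ u := hu
  have hK := h.KV_pos
  have hC : 0 < C := hK.trans_le hKC
  set ν := lam - 2 * KV with hνdef
  have hν : 0 < ν := by linarith [h.seven_mul_KV_le]
  set d : Fin N → ℝ := fun i => |x s i - ξ i| + avg fun k => |x s k - ξ k| with hd
  set m := avg fun k => |x s k - ξ k| with hm
  have hm0 : 0 ≤ m := avg_nonneg fun k => abs_nonneg _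
  have hd0 : ∀ i, 0 ≤ d i := fun i => add_nonneg (abs_nonneg _) hm0
  have havd : avg d = 2 * m := by
    rw [hd, avg_add (fun i => |x s i - ξ i|) fun _ => m, avg_const]; ring
  -- The bound of `abs_linDrift_sub_le` with the distance of the flows replaced by `d` and the first
  -- variation by its weight, both stripped of their exponential factors.
  set φ : Fin N → ℝ := fun i => C * (d i * weight j i
    + avg fun k => (d i + d k) * (weight j i + weight j k)) with hφ
  have hφ0 : ∀ i, 0 ≤ φ i := fun i => mul_nonneg hC.le (add_nonneg
    (mul_nonneg (hd0 i) (weight_nonneg j i)) (avg_nonneg fun k => mul_nonneg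
      (add_nonneg (hd0 i) (hd0 k)) (add_nonneg (weight_nonneg j i) (weight_nonneg j k))))
  have hφeq : ∀ i, φ i = C * (2 * (weight j i * d i) + 2 / N * d i + 2 * m * weight j i
      + (d j + 2 * m) / N) := by
    intro i
    have h1 : (fun k => (d i + d k) * (weight j i + weight j k)) = fun k =>
        ((d i * weight j i + d i * weight j k) + weight j i * d k) + weight j k * d k := by
      ext k; ring
    simp only [hφ]
    rw [h1, avg_add (fun k => (d i * weight j i + d i * weight j k) + weight j i * d k)
      fun k => weight j k * d k, avg_add (fun k => d i * weight j i + d i * weight j k)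
      fun k => weight j i * d k, avg_add (fun _ => d i * weight j i) fun k => d i * weight j k,
      avg_const, avg_mul_left, avg_mul_left, avg_weight_mul, havd,
      show avg (fun k => weight j k) = 2 / N from avg_weight j]
    ring
  have havφ : avg φ = C * ((3 * d j + 14 * m) / N) := by
    have h1 : φ = fun i => C * (2 * (weight j i * d i) + 2 / N * d i + 2 * m * weight j i
      + (d j + 2 * m) / N) := funext hφeq
    rw [h1, avg_mul_left, avg_add (fun i => 2 * (weight j i * d i) + 2 / N * d i
      + 2 * m * weight j i) fun _ => (d j + 2 * m) / N, avg_add (fun i => 2 * (weight j i * d i)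
      + 2 / N * d i) fun i => 2 * m * weight j i, avg_add (fun i => 2 * (weight j i * d i))
      fun i => 2 / N * d i, avg_mul_left, avg_mul_left, avg_mul_left, avg_weight_mul, avg_const,
      show avg (fun k => weight j k) = 2 / N from avg_weight j,
      havd]
    ring
  set a : Fin N → ℝ := fun i => 4 * C * weight j i * ((s : ℝ) - t) with ha
  have ha0 : ∀ i, 0 ≤ a i := fun i => mul_nonneg (mul_nonneg (by positivity) (weight_nonneg j i))
    (sub_nonneg.2 hts')
  have hava : avg a = 4 * C * (2 / N) * ((s : ℝ) - t) := by
    have h1 : a = fun i => 4 * C * ((s : ℝ) - t) * weight j i := by ext i; simp only [ha]; ring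
    rw [h1, avg_mul_left, show avg (fun k => weight j k) = 2 / N from avg_weight j]; ring
  -- The discrepancy `a` at time `s` plus the primitive of `Real.exp (-ν * (r - s)) * φ i`, which
  -- stays below `ν⁻¹ * φ i` for all time.
  set b : ℝ → Fin N → ℝ := fun r i => a i + ν⁻¹ * (1 - Real.exp (-ν * (r - s))) * φ i with hb
  have hb' : ∀ i r, HasDerivAt (fun r => b r i) (Real.exp (-ν * (r - s)) * φ i) r := by
    intro i r
    have h1 := ((((((hasDerivAt_id r).sub_const (s : ℝ)).const_mul (-ν)).exp.const_sub
      1).const_mul ν⁻¹).mul_const (φ i)).const_add (a i)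
    refine h1.congr_deriv ?_
    simp only [id]
    field_simp
  have hbT : ∀ i, b u i ≤ a i + ν⁻¹ * φ i := fun i => by
    simp only [hb]
    have := mul_nonneg (mul_nonneg (inv_nonneg.2 hν.le) (Real.exp_pos (-ν * (u - s))).le) (hφ0 i)
    linarith
  have hmain := abs_le_of_meanField_dissipative (lam := lam) (T := u) h.KV_pos hsu'
    (v := fun r i => J r.toNNReal i j - J' r.toNNReal i j)
    (v' := fun r i => linDrift U V i (x r.toNNReal) (fun k => J r.toNNReal k j)
      - linDrift U V i (y r.toNNReal) (fun k => J' r.toNNReal k j))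
    (b := b) (b' := fun r i => Real.exp (-ν * (r - s)) * φ i)
    ?_ ?_ (fun i r _ => (hb' i r).continuousAt.continuousWithinAt)
    (fun i r _ => (hb' i r).hasDerivWithinAt) ?_
    (fun i r _ => mul_nonneg (Real.exp_pos _).le (hφ0 i)) ?_ ?_ i
  · simp only [Real.toNNReal_coe] at hmain
    refine hmain.trans (mul_le_mul_of_nonneg_left ?_ (Real.exp_pos _).le)
    have havb : avg (b u) ≤ avg a + ν⁻¹ * avg φ := by
      rw [← avg_mul_left, ← avg_add]; exact avg_mono hbT
    refine (add_le_add (hbT i) havb).trans ?_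
    have hwi := one_div_le_weight j i
    have h1 : φ i ≤ weight j i * (C * (4 * d i + d j + 4 * m)) := by
      rw [hφeq]
      have h2 := mul_le_mul_of_nonneg_right hwi
        (by linarith [hd0 i, hd0 j] : 0 ≤ 2 * d i + d j + 2 * m)
      have h3 := mul_le_mul_of_nonneg_left h2 hC.le
      have h4 : (d j + 2 * m) / N = 1 / N * (d j + 2 * m) := by ring
      have h5 : (2 : ℝ) / N = 2 * (1 / N) := by ring
      rw [h4, h5]
      linarith
    have h2 : avg φ ≤ weight j i * (C * (3 * d j + 14 * m)) := by
      rw [havφ]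
      have h3 := mul_le_mul_of_nonneg_left (mul_le_mul_of_nonneg_right hwi
        (by linarith [hd0 j] : 0 ≤ 3 * d j + 14 * m)) hC.le
      have h4 : (3 * d j + 14 * m) / N = 1 / N * (3 * d j + 14 * m) := by ring
      rw [h4]
      linarith
    have h3 : avg a ≤ weight j i * (C * (8 * ((s : ℝ) - t))) := by
      rw [hava]
      have := mul_le_mul_of_nonneg_left (mul_le_mul_of_nonneg_right hwi
        (sub_nonneg.2 hts')) hC.le
      have h5 : (2 : ℝ) / N = 2 * (1 / N) := by ring
      rw [h5]
      linarith
    have h4 := mul_le_mul_of_nonneg_left (add_le_add h1 h2) (inv_nonneg.2 hν.le)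
    -- Each `d` contributes one more `m`: 18 + 4 + 4 = 26. The 12 in the statement is 4 from `a i`
    -- plus 8 from `avg a`.
    have h5 : 4 * d i + d j + 4 * m + (3 * d j + 14 * m)
        = 4 * |x s i - ξ i| + 4 * |x s j - ξ j| + 26 * m := by simp only [hd]; ring
    rw [← h5]
    have h6 : a i = weight j i * (C * (4 * ((s : ℝ) - t))) := by simp only [ha]; ring
    rw [h6]
    linarith
  · intro i
    have h1 := continuousOn_pi.1 (continuousOn_pi.1 ((continuousOn_comp_toNNReal hJc).mono
      (Set.Icc_subset_Ici_self.trans (Set.Ici_subset_Ici.2 hts') : Set.Icc (s : ℝ) u ⊆ _)) i) j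
    exact h1.sub (continuousOn_pi.1 (continuousOn_pi.1
      ((continuousOn_comp_toNNReal hJc').mono Set.Icc_subset_Ici_self) i) j)
  · intro i r hr
    exact (hasDerivWithinAt_firstVariation h hxc hJc hJ i j (hts'.trans hr.1)).sub
      (hasDerivWithinAt_firstVariation h hyc hJc' hJ' i j hr.1)
  · intro i r hr
    have : Real.exp (-ν * (r - s)) ≤ 1 := Real.exp_le_one_iff.2
      (by nlinarith [mul_nonneg hν.le (sub_nonneg.2 hr.1)])
    exact add_nonneg (ha0 i) (mul_nonneg (mul_nonneg (inv_nonneg.2 hν.le) (by linarith)) (hφ0 i))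
  · intro i r hr
    have hE := Real.exp_pos (-ν * (r - s))
    have hD : ∀ k, |x r.toNNReal k - y r.toNNReal k| ≤ Real.exp (-ν * (r - s)) * d k := fun k =>
      abs_flow_sub_le h hts hxc hyc hx hy hr.1 k
    have hv : ∀ k, |J r.toNNReal k j| ≤ Real.exp (-ν * (r - s)) * weight j k := fun k =>
      (abs_firstVariation_le h hxc hJc hJ (hts'.trans hr.1) k j).trans
        (mul_le_mul_of_nonneg_right (Real.exp_le_exp.2
          (by nlinarith [mul_nonneg hν.le (sub_nonneg.2 hts')])) (weight_nonneg j k))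
    have hforce : |linDrift U V i (x r.toNNReal) (fun k => J r.toNNReal k j)
        - linDrift U V i (y r.toNNReal) (fun k => J r.toNNReal k j)|
        ≤ Real.exp (-ν * (r - s)) * (Real.exp (-ν * (r - s)) * φ i) := by
      refine (abs_linDrift_sub_le hC hU3 hV3 i _ _ _).trans ?_
      simp only [hφ]
      rw [← mul_assoc, mul_left_comm]
      refine mul_le_mul_of_nonneg_left ?_ hC.le
      rw [mul_add, ← avg_mul_left]
      refine add_le_add ?_ (avg_mono fun k => ?_)
      · refine (mul_le_mul (hD i) (hv i) (abs_nonneg _) (mul_nonneg hE.le (hd0 i))).trans_eq ?_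
        ring
      · refine (mul_le_mul (add_le_add (hD i) (hD k)) (add_le_add (hv i) (hv k))
          (by positivity) (add_nonneg (mul_nonneg hE.le (hd0 i))
            (mul_nonneg hE.le (hd0 k)))).trans_eq ?_
        ring
    -- The difference of the velocities is the linearisation at `y` applied to `J - J'`, which
    -- dissipates, plus the change of base point applied to `J`, which is the forcing.
    have hdiss := mul_linDrift_le h i (y r.toNNReal) fun k => J r.toNNReal k j - J' r.toNNReal k j
    rw [linDrift_sub i (y r.toNNReal) (fun k => J r.toNNReal k j)
      fun k => J' r.toNNReal k j] at hdiss
    have h1 : (J r.toNNReal i j - J' r.toNNReal i j)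
        * (linDrift U V i (x r.toNNReal) (fun k => J r.toNNReal k j)
          - linDrift U V i (y r.toNNReal) (fun k => J r.toNNReal k j))
        ≤ |J r.toNNReal i j - J' r.toNNReal i j|
          * (Real.exp (-ν * (r - s)) * (Real.exp (-ν * (r - s)) * φ i)) := by
      refine (le_abs_self _).trans ?_
      rw [abs_mul]
      exact mul_le_mul_of_nonneg_left hforce (abs_nonneg _)
    simp only [← hνdef]
    linarith
  · intro i
    have h1 := hJ' s le_rfl i j
    simp only [intervalIntegral.integral_same, add_zero] at h1
    have h2 := abs_firstVariation_sub_ite_le h hKC hU2 hts hxc hJc hJ i j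
    simpa [hb, h1] using h2

end paths

/-! ### Integral inequalities and short-time displacement -/

theorem sq_intervalIntegral_le {a b : ℝ} (hab : a ≤ b) {f : ℝ → ℝ} (hf : Continuous f) :
    (∫ r in a..b, f r) ^ 2 ≤ (b - a) * ∫ r in a..b, f r ^ 2 := by
  rcases hab.eq_or_lt with rfl | hlt
  · simp
  have hpos : 0 < b - a := sub_pos.2 hlt
  set c := (∫ r in a..b, f r) / (b - a) with hc
  have h1 : 0 ≤ ∫ r in a..b, (f r - c) ^ 2 :=
    intervalIntegral.integral_nonneg hab fun r _ => sq_nonneg _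
  have h2 : ∫ r in a..b, (f r - c) ^ 2
      = (∫ r in a..b, f r ^ 2) - 2 * c * (∫ r in a..b, f r) + (b - a) * c ^ 2 := by
    have h3 : (fun r => (f r - c) ^ 2) = fun r => f r ^ 2 - 2 * c * f r + c ^ 2 := by
      ext r; ring
    rw [h3, intervalIntegral.integral_add
      ((by fun_prop : Continuous fun r => f r ^ 2 - 2 * c * f r).intervalIntegrable _ _)
      (continuous_const.intervalIntegrable _ _), intervalIntegral.integral_sub
      ((by fun_prop : Continuous fun r => f r ^ 2).intervalIntegrable _ _)
      ((by fun_prop : Continuous fun r => 2 * c * f r).intervalIntegrable _ _),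
      intervalIntegral.integral_const_mul, intervalIntegral.integral_const, smul_eq_mul]
  have h4 : (∫ r in a..b, f r) = c * (b - a) := by rw [hc]; field_simp
  rw [h2, h4] at h1
  rw [h4]
  nlinarith

section average
variable {N : ℕ}

theorem integrable_avg {α : Type*} {m : MeasurableSpace α} {μ : Measure α} {f : α → Fin N → ℝ}
    (hf : ∀ k, Integrable (fun a => f a k) μ) : Integrable (fun a => avg (f a)) μ :=
  (integrable_finsetSum _ fun k _ => hf k).const_mul _

theorem integral_avg {α : Type*} {m : MeasurableSpace α} {μ : Measure α} {f : α → Fin N → ℝ}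
    (hf : ∀ k, Integrable (fun a => f a k) μ) :
    ∫ a, avg (f a) ∂μ = avg fun k => ∫ a, f a k ∂μ := by
  simp only [avg]
  rw [integral_const_mul, integral_finsetSum _ fun k _ => hf k]

theorem intervalIntegral_avg {a b : ℝ} {f : ℝ → Fin N → ℝ}
    (hf : ∀ k, Continuous fun r => f r k) :
    ∫ r in a..b, avg (f r) = avg fun k => ∫ r in a..b, f r k := by
  simp only [avg]
  rw [intervalIntegral.integral_const_mul, intervalIntegral.integral_finsetSum
    fun k _ => (hf k).intervalIntegrable _ _]

theorem continuous_avg {α : Type*} [TopologicalSpace α] {f : α → Fin N → ℝ}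
    (hf : ∀ k, Continuous fun a => f a k) : Continuous fun a => avg (f a) := by
  unfold avg; fun_prop

end average

/-- Pathwise short-time estimate of the displacement of the particles from their starting points. -/
theorem sq_displacement_le {U V : ℝ → ℝ} {lam KV C σ : ℝ} {N : ℕ} {t s : ℝ≥0} {ξ : Fin N → ℝ}
    {w : Fin N → ℝ≥0 → ℝ} {x : ℝ≥0 → Fin N → ℝ} (h : PotentialAssumption U V lam KV)
    (hKC : KV ≤ C) (hU0 : |deriv U 0| ≤ C) (hU2 : ∀ x, |deriv (deriv U) x| ≤ C)
    (hts : t ≤ s) (hst : (s : ℝ) - t ≤ 1) (hw : ∀ i, Continuous (w i))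
    (hxc : ContinuousOn x (Set.Ici t))
    (hx : ∀ u, t ≤ u → ∀ i, x u i = ξ i
      + (∫ r in (t : ℝ)..(u : ℝ), drift U V i (x r.toNNReal)) + σ * (w i u - w i t))
    (i : Fin N) :
    (x s i - ξ i) ^ 2 ≤ 2 * σ ^ 2 * (w i s - w i t) ^ 2
      + 192 * C ^ 2 * Real.exp (lam - 2 * KV) ^ 2 * (((s : ℝ) - t)
        * (((s : ℝ) - t) * (1 + ξ i ^ 2 + avg fun k => ξ k ^ 2)
          + σ ^ 2 * ((∫ r in (t : ℝ)..(s : ℝ), (w i r.toNNReal - w i t) ^ 2)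
            + avg fun k => ∫ r in (t : ℝ)..(s : ℝ), (w k r.toNNReal - w k t) ^ 2))) := by
  have : NeZero N := ⟨fun h0 => by subst h0; exact i.elim0⟩
  have hts' : (t : ℝ) ≤ s := hts
  have hC : 0 < C := h.KV_pos.trans_le hKC
  set ν := lam - 2 * KV with hνdef
  have hν : 0 < ν := by linarith [h.seven_mul_KV_le, h.KV_pos]
  set e := Real.exp ν with he
  have he0 : 0 < e := Real.exp_pos ν
  -- The path without drift. The difference of `x` and `z` is differentiable and is forced by the
  -- drift evaluated at `z`.
  set z : ℝ → Fin N → ℝ := fun r k => ξ k + σ * (w k r.toNNReal - w k t) with hz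
  have hzc : ∀ k, Continuous fun r => z r k := fun k => by
    have := (hw k).comp continuous_real_toNNReal
    simp only [hz]
    fun_prop
  -- The comparison measures forcing relative to exp(-ν(r - t)); the factor `e` makes up for this
  -- since `r - t ≤ 1`.
  set g : ℝ → Fin N → ℝ := fun r k =>
    e * (C * (1 + 2 * |z r k| + avg fun l => |z r l|)) with hg
  have hgc : ∀ k, Continuous fun r => g r k := fun k => by
    have h1 := hzc k
    have h2 : Continuous fun r => avg fun l => |z r l| := continuous_avg fun l => (hzc l).abs
    simp only [hg]
    fun_prop
  have hav0 : ∀ r, 0 ≤ avg fun l => |z r l| := fun r => avg_nonneg fun l => abs_nonneg _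
  have hg0 : ∀ r k, 0 ≤ g r k := fun r k => by
    have := hav0 r
    simp only [hg]
    positivity
  set b : ℝ → Fin N → ℝ := fun u k => ∫ r in (t : ℝ)..u, g r k with hb
  have hbd : ∀ k u, HasDerivAt (fun u => b u k) (g u k) u := fun k u =>
    intervalIntegral.integral_hasDerivAt_right ((hgc k).intervalIntegrable _ _)
      (hgc k).aestronglyMeasurable.stronglyMeasurableAtFilter (hgc k).continuousAt
  have hmain := abs_le_of_meanField_dissipative (lam := lam) (T := s) h.KV_pos hts'
    (v := fun r k => x r.toNNReal k - σ * (w k r.toNNReal - w k t) - ξ k)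
    (v' := fun r k => drift U V k (x r.toNNReal)) (b := b) (b' := g) ?_
    (fun k u hu => (hasDerivWithinAt_flow h hxc hx k hu.1).sub_const _)
    (fun k u _ => (hbd k u).continuousAt.continuousWithinAt)
    (fun k u _ => (hbd k u).hasDerivWithinAt)
    (fun k u hu => intervalIntegral.integral_nonneg hu.1 fun r _ => hg0 r k)
    (fun k u _ => hg0 u k) ?_ ?_ i
  · simp only [Real.toNNReal_coe] at hmain
    set P : ℝ → ℝ := fun r => g r i + avg (g r) with hP
    have hPc : Continuous P := (hgc i).add (continuous_avg hgc)
    have hbP : b s i + avg (b s) = ∫ r in (t : ℝ)..(s : ℝ), P r := by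
      simp only [hP, hb]
      rw [intervalIntegral.integral_add ((hgc i).intervalIntegrable _ _)
        ((continuous_avg hgc).intervalIntegrable _ _), intervalIntegral_avg hgc]
    have hPeq : ∀ r, P r = e * C * (2 + 2 * |z r i| + 4 * avg fun l => |z r l|) := fun r => by
      have h1 : avg (g r) = e * (C * (1 + 2 * (avg fun l => |z r l|) + avg fun l => |z r l|)) := by
        simp only [hg]
        rw [avg_mul_left, avg_mul_left, avg_add (fun k => 1 + 2 * |z r k|)
          fun _ => avg fun l => |z r l|, avg_add (fun _ => 1) fun k => 2 * |z r k|, avg_const,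
          avg_const, avg_mul_left]
      simp only [hP]
      rw [h1]
      simp only [hg]
      ring
    set Q : ℝ → ℝ := fun r => 96 * C ^ 2 * e ^ 2 * ((1 + ξ i ^ 2 + avg fun k => ξ k ^ 2)
      + σ ^ 2 * ((w i r.toNNReal - w i t) ^ 2 + avg fun k => (w k r.toNNReal - w k t) ^ 2)) with hQ
    have hwc : ∀ k, Continuous fun r : ℝ => (w k r.toNNReal - w k t) ^ 2 := fun k =>
      (((hw k).comp continuous_real_toNNReal).sub continuous_const).pow 2
    have hwac := continuous_avg (f := fun (r : ℝ) k => (w k r.toNNReal - w k t) ^ 2) hwc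
    have hQc : Continuous Q := by
      have := hwc i
      simp only [hQ]
      fun_prop
    have hzsq : ∀ r k, z r k ^ 2 ≤ 2 * ξ k ^ 2 + 2 * σ ^ 2 * (w k r.toNNReal - w k t) ^ 2 :=
      fun r k => by
        simp only [hz]
        nlinarith [sq_nonneg (ξ k - σ * (w k r.toNNReal - w k t))]
    have hPQ : ∀ r, P r ^ 2 ≤ Q r := fun r => by
      have h1 := avg_sq_le fun l => |z r l|
      simp only [sq_abs] at h1
      have h2 := h1.trans (avg_mono (hzsq r))
      rw [avg_add (fun k => 2 * ξ k ^ 2) fun k => 2 * σ ^ 2 * (w k r.toNNReal - w k t) ^ 2,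
        avg_mul_left, avg_mul_left] at h2
      have h3 := hzsq r i
      rw [← sq_abs] at h3
      rw [hPeq, mul_pow]
      -- The constant is 96 = 3·16·2: three summands, the coefficient 4 squared, and the 2 of
      -- `hzsq`. The final 192 doubles it when the noise is added back.
      have h4 : (2 + 2 * |z r i| + 4 * avg fun l => |z r l|) ^ 2
          ≤ 96 * ((1 + ξ i ^ 2 + avg fun k => ξ k ^ 2)
            + σ ^ 2 * ((w i r.toNNReal - w i t) ^ 2
              + avg fun k => (w k r.toNNReal - w k t) ^ 2)) := by
        have h5 : (2 + 2 * |z r i| + 4 * avg fun l => |z r l|) ^ 2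
            ≤ 3 * (4 + 4 * |z r i| ^ 2 + 16 * (avg fun l => |z r l|) ^ 2) := by
          nlinarith [sq_nonneg (2 - 2 * |z r i|), sq_nonneg (2 - 4 * avg fun l => |z r l|),
            sq_nonneg (2 * |z r i| - 4 * avg fun l => |z r l|)]
        have h6 : 0 ≤ σ ^ 2 * (w i r.toNNReal - w i t) ^ 2 := by positivity
        have h7 := sq_nonneg (ξ i)
        linarith
      have := mul_le_mul_of_nonneg_left h4 (sq_nonneg (e * C))
      simp only [hQ]
      linarith
    have hintQ : ∫ r in (t : ℝ)..(s : ℝ), Q r = 96 * C ^ 2 * e ^ 2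
        * (((s : ℝ) - t) * (1 + ξ i ^ 2 + avg fun k => ξ k ^ 2)
          + σ ^ 2 * ((∫ r in (t : ℝ)..(s : ℝ), (w i r.toNNReal - w i t) ^ 2)
            + avg fun k => ∫ r in (t : ℝ)..(s : ℝ), (w k r.toNNReal - w k t) ^ 2)) := by
      have hsum : Continuous fun r : ℝ => σ ^ 2 * ((w i r.toNNReal - w i t) ^ 2
          + avg fun k => (w k r.toNNReal - w k t) ^ 2) := continuous_const.mul ((hwc i).add hwac)
      simp only [hQ]
      rw [intervalIntegral.integral_const_mul, intervalIntegral.integral_add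
        (continuous_const.intervalIntegrable _ _) (hsum.intervalIntegrable _ _),
        intervalIntegral.integral_const_mul, intervalIntegral.integral_const,
        intervalIntegral.integral_add ((hwc i).intervalIntegrable _ _)
        (hwac.intervalIntegrable _ _), intervalIntegral_avg hwc, smul_eq_mul]
    have hY : |x s i - σ * (w i s - w i t) - ξ i| ≤ ∫ r in (t : ℝ)..(s : ℝ), P r := by
      rw [← hbP]
      refine hmain.trans (mul_le_of_le_one_left ?_ (Real.exp_le_one_iff.2 ?_))
      · rw [hbP]
        exact intervalIntegral.integral_nonneg hts' fun r _ =>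
          add_nonneg (hg0 r i) (avg_nonneg fun k => hg0 r k)
      · nlinarith [mul_nonneg hν.le (sub_nonneg.2 hts')]
    have hY2 := pow_le_pow_left₀ (abs_nonneg _) hY 2
    rw [sq_abs] at hY2
    have h8 := sq_intervalIntegral_le hts' hPc
    have h9 := mul_le_mul_of_nonneg_left (intervalIntegral.integral_mono_on (μ := volume) hts'
      ((hPc.pow 2).intervalIntegrable _ _) (hQc.intervalIntegrable _ _) fun r _ => hPQ r)
      (sub_nonneg.2 hts')
    rw [hintQ] at h9
    have h10 : (x s i - ξ i) ^ 2 ≤ 2 * (x s i - σ * (w i s - w i t) - ξ i) ^ 2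
        + 2 * σ ^ 2 * (w i s - w i t) ^ 2 := by
      nlinarith [sq_nonneg (x s i - σ * (w i s - w i t) - ξ i - σ * (w i s - w i t))]
    have h11 := hY2.trans (h8.trans h9)
    linarith
  · intro k
    have h1 := continuousOn_pi.1
      ((continuousOn_comp_toNNReal hxc).mono Set.Icc_subset_Ici_self : ContinuousOn _
        (Set.Icc (t : ℝ) s)) k
    have h2 := ((hw k).comp continuous_real_toNNReal).continuousOn (s := Set.Icc (t : ℝ) s)
    exact (h1.sub (continuousOn_const.mul (h2.sub continuousOn_const))).sub continuousOn_const
  · intro k r hr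
    have hY : ∀ l, x r.toNNReal l - σ * (w l r.toNNReal - w l t) - ξ l
        = x r.toNNReal l - z r l := fun l => by simp only [hz]; ring
    simp only [hY]
    have h1 := sub_mul_drift_sub_le h k (x r.toNNReal) (z r)
    have h2 : (x r.toNNReal k - z r k) * drift U V k (z r)
        ≤ |x r.toNNReal k - z r k| * (Real.exp (-ν * (r - t)) * g r k) := by
      refine (le_abs_self _).trans ?_
      rw [abs_mul]
      refine mul_le_mul_of_nonneg_left ?_ (abs_nonneg _)
      refine (abs_drift_le h hKC hU0 hU2 k (z r)).trans ?_
      simp only [hg, he]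
      rw [← mul_assoc, ← Real.exp_add]
      refine le_mul_of_one_le_left ?_ (Real.one_le_exp ?_)
      · have := hav0 r
        positivity
      · nlinarith [mul_nonneg hν.le (by linarith [hr.1, hr.2] : 0 ≤ 1 - (r - t))]
    linarith
  · intro k
    have := hx t le_rfl k
    simp only [intervalIntegral.integral_same, add_zero, sub_self, mul_zero] at this
    simp [hb, this]

/-! ### Mean squares of Brownian increments -/

section Brownian
variable {Ω : Type*} {m : MeasurableSpace Ω} {P : Measure Ω} {B : ℝ≥0 → Ω → ℝ}

theorem integrable_sq_brownian_sub (hB : IsPreBrownianReal B P) (r t : ℝ≥0) :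
    Integrable (fun ω => (B r ω - B t ω) ^ 2) P := by
  have hL := hB.hasLaw_sub r t
  have h1 : MemLp id 2 (P.map (B r - B t)) := by
    rw [hL.map_eq]; exact memLp_id_gaussianReal' 2 (by norm_num)
  exact ((memLp_map_measure_iff aestronglyMeasurable_id hL.aemeasurable).1 h1).integrable_sq

theorem integral_sq_brownian_sub (hB : IsPreBrownianReal B P) {r t : ℝ≥0} (htr : t ≤ r) :
    ∫ ω, (B r ω - B t ω) ^ 2 ∂P = (r : ℝ) - t := by
  have hL := hB.hasLaw_sub r t
  have h1 := hL.integral_comp (f := fun x : ℝ => x ^ 2) (by fun_prop)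
  have h2 : ∫ x, x ^ 2 ∂gaussianReal 0 (nndist r.1 t.1) = (r : ℝ) - t := by
    have h3 := variance_of_integral_eq_zero (μ := gaussianReal 0 (nndist r.1 t.1))
      (X := fun x => x) aemeasurable_id (integral_id_gaussianReal)
    rw [← h3, variance_fun_id_gaussianReal, coe_nndist, Real.dist_eq]
    exact abs_of_nonneg (sub_nonneg.2 htr)
  rw [← h2, ← h1]
  rfl

/-- A Brownian motion has a jointly measurable version with the same paths almost surely. -/
theorem exists_measurable_uncurry_brownian (hB : IsBrownianReal B P) (hm : ∀ r, Measurable (B r)) :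
    ∃ B' : ℝ≥0 → Ω → ℝ, Measurable (Function.uncurry B') ∧ ∀ᵐ ω ∂P, ∀ r, B' r ω = B r ω := by
  -- The set of discontinuous paths need not be measurable; the process is set to zero on a
  -- measurable null set containing it.
  set S := toMeasurable P {ω | ¬Continuous fun r => B r ω} with hS
  have hS0 : P S = 0 := by rw [hS, measure_toMeasurable]; exact ae_iff.1 hB.cont
  have hSm : MeasurableSet S := measurableSet_toMeasurable _ _
  refine ⟨fun r => Sᶜ.indicator (B r), ?_, ?_⟩
  · refine measurable_uncurry_of_continuous_of_measurable (fun ω => ?_)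
      fun r => (hm r).indicator hSm.compl
    by_cases hω : ω ∈ S
    · simpa [Set.indicator, hω] using continuous_const
    · have : Continuous fun r => B r ω := by
        by_contra hc
        exact hω (subset_toMeasurable P _ hc)
      simpa [Set.indicator, hω] using this
  · filter_upwards [measure_eq_zero_iff_ae_notMem.1 hS0] with ω hω r
    simp [Set.indicator, hω]

theorem integrable_integral_sq_brownian_sub [IsFiniteMeasure P] (hB : IsBrownianReal B P)
    (hm : ∀ r, Measurable (B r)) {t s : ℝ≥0} (hts : t ≤ s) :
    Integrable (fun ω => ∫ r in (t : ℝ)..(s : ℝ), (B r.toNNReal ω - B t ω) ^ 2) P ∧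
      ∫ ω, (∫ r in (t : ℝ)..(s : ℝ), (B r.toNNReal ω - B t ω) ^ 2) ∂P ≤ ((s : ℝ) - t) ^ 2 := by
  obtain ⟨B', hB'm, hB'⟩ := exists_measurable_uncurry_brownian hB hm
  have hts' : (t : ℝ) ≤ s := hts
  set f : ℝ → Ω → ℝ := fun r ω => (B' r.toNNReal ω - B' t ω) ^ 2 with hf
  set μ := volume.restrict (Set.Ioc (t : ℝ) s) with hμ
  have hfae : ∀ᵐ ω ∂P, ∀ r : ℝ, f r ω = (B r.toNNReal ω - B t ω) ^ 2 := by
    filter_upwards [hB'] with ω hω r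
    simp only [hf, hω]
  have hfr : ∀ r : ℝ, f r =ᵐ[P] fun ω => (B r.toNNReal ω - B t ω) ^ 2 := fun r =>
    hfae.mono fun ω hω => hω r
  have hfm : Measurable (Function.uncurry f) := by
    have h1 : Measurable fun p : ℝ × Ω => B' p.1.toNNReal p.2 :=
      hB'm.comp (by fun_prop : Measurable fun p : ℝ × Ω => (p.1.toNNReal, p.2))
    have h2 : Measurable fun p : ℝ × Ω => B' t p.2 :=
      hB'm.comp (by fun_prop : Measurable fun p : ℝ × Ω => (t, p.2))
    exact (h1.sub h2).pow_const 2
  have hfint : ∀ r : ℝ, (t : ℝ) ≤ r → ∫ ω, f r ω ∂P = r - t := fun r hr => by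
    rw [integral_congr_ae (hfr r), integral_sq_brownian_sub hB.toIsPreBrownianReal
      (NNReal.le_toNNReal_of_coe_le hr), Real.coe_toNNReal r (t.coe_nonneg.trans hr)]
  have hmem : ∀ᵐ r ∂μ, r ∈ Set.Ioc (t : ℝ) s := ae_restrict_mem measurableSet_Ioc
  have hlin : Continuous fun r : ℝ => r - t := by fun_prop
  have hlini : Integrable (fun r : ℝ => r - t) μ :=
    (hlin.integrableOn_Icc (a := (t : ℝ)) (b := s)).mono_set Set.Ioc_subset_Icc_self
  have hprod : Integrable (Function.uncurry f) (μ.prod P) := by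
    rw [integrable_prod_iff hfm.aestronglyMeasurable]
    refine ⟨Filter.Eventually.of_forall fun r =>
      (integrable_sq_brownian_sub hB.toIsPreBrownianReal _ _).congr (hfr r).symm,
      hlini.congr ?_⟩
    filter_upwards [hmem] with r hr
    rw [← hfint r hr.1.le]
    refine integral_congr_ae (Filter.Eventually.of_forall fun ω => ?_)
    simp only [Function.uncurry_apply_pair, hf, Real.norm_eq_abs, abs_sq]
  have hae : (fun ω => ∫ r in (t : ℝ)..(s : ℝ), (B r.toNNReal ω - B t ω) ^ 2)
      =ᵐ[P] fun ω => ∫ r, f r ω ∂μ := by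
    filter_upwards [hfae] with ω hω
    simp only [intervalIntegral.integral_of_le hts', hω, hμ]
  refine ⟨(hprod.integral_prod_right).congr hae.symm, ?_⟩
  rw [integral_congr_ae hae, ← integral_integral_swap hprod]
  calc ∫ r, (∫ ω, f r ω ∂P) ∂μ = ∫ r, r - t ∂μ :=
        integral_congr_ae (hmem.mono fun r hr => hfint r hr.1.le)
    _ ≤ ∫ _, (s : ℝ) - t ∂μ :=
        integral_mono_ae hlini (integrable_const _) (hmem.mono fun r hr => by
          simpa using hr.2)
    _ = ((s : ℝ) - t) ^ 2 := by
        rw [integral_const, hμ, measureReal_restrict_apply_univ, Real.volume_real_Ioc_of_le hts',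
          smul_eq_mul, sq]

end Brownian

/-! ### Mean square estimates -/

theorem integral_sq_le_of_integral_pow_four_le {Ω : Type*} {m : MeasurableSpace Ω} {P : Measure Ω}
    [IsProbabilityMeasure P] {f : Ω → ℝ} {M : ℝ} (hf : MemLp f 4 P)
    (hM : ∫ ω, |f ω| ^ 4 ∂P ≤ M) :
    Integrable (fun ω => f ω ^ 2) P ∧ ∫ ω, f ω ^ 2 ∂P ≤ 1 + M := by
  have h2 : Integrable (fun ω => f ω ^ 2) P :=
    (hf.mono_exponent (by norm_num : (2 : ENNReal) ≤ 4)).integrable_sq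
  have h4 : Integrable (fun ω => |f ω| ^ 4) P := hf.integrable_norm_pow (by norm_num)
  refine ⟨h2, (integral_mono h2 ((integrable_const (1 : ℝ)).add h4) fun ω => ?_).trans ?_⟩
  · have : |f ω| ^ 4 = (f ω ^ 2) ^ 2 := by rw [← sq_abs (f ω)]; ring
    simp only [Pi.add_apply, this]
    nlinarith [sq_nonneg (f ω ^ 2 - 1), sq_nonneg (f ω)]
  · simp only [Pi.add_apply]
    rw [integral_add (integrable_const _) h4]
    simpa using hM

/-- The mean square displacement of the particles during `[t, s]` is at most of order `s - t`. -/
theorem IsParticleFlow.integral_sq_displacement_le {U V : ℝ → ℝ} {lam KV C σ M : ℝ}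
    (h : PotentialAssumption U V lam KV) (hKC : KV ≤ C) (hU0 : |deriv U 0| ≤ C)
    (hU2 : ∀ x, |deriv (deriv U) x| ≤ C) {N : ℕ} {Ω : Type*} {m : MeasurableSpace Ω}
    {P : Measure Ω} [IsProbabilityMeasure P] {ℱ : Filtration ℝ≥0 m} {W : Fin N → ℝ≥0 → Ω → ℝ}
    (hW : IsFilteredBrownian P ℱ W) {t s : ℝ≥0} (hts : t ≤ s) (hst : (s : ℝ) - t ≤ 1)
    {ξ : Ω → Fin N → ℝ} (hξm : Measurable[ℱ t] ξ) (hξ : ∀ i, MemLp (fun ω => ξ ω i) 4 P)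
    (hM : ∀ i, ∫ ω, |ξ ω i| ^ 4 ∂P ≤ M) {X : ℝ≥0 → Ω → Fin N → ℝ}
    (hX : IsParticleFlow P ℱ U V σ W t ξ X) (i : Fin N) :
    Integrable (fun ω => (X s ω i - ξ ω i) ^ 2) P ∧
      ∫ ω, (X s ω i - ξ ω i) ^ 2 ∂P ≤ (2 * σ ^ 2 + 192 * C ^ 2 * Real.exp (lam - 2 * KV) ^ 2
        * (1 + 2 * (1 + M) + 2 * σ ^ 2)) * ((s : ℝ) - t) := by
  have : NeZero N := ⟨fun h0 => by subst h0; exact i.elim0⟩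
  have hh : 0 ≤ (s : ℝ) - t := sub_nonneg.2 hts
  set d := (s : ℝ) - t with hd
  have hWm : ∀ k r, Measurable (W k r) := fun k r => (hW.adapted k r).mono (ℱ.le r) le_rfl
  have hB := fun k => (hW.brownian k).toIsPreBrownianReal
  have hZ := fun k => integrable_integral_sq_brownian_sub (hW.brownian k) (hWm k) hts
  have hξ2 := fun k => integral_sq_le_of_integral_pow_four_le (hξ k) (hM k)
  have hinc : Integrable (fun ω => (W i s ω - W i t ω) ^ 2) P :=
    integrable_sq_brownian_sub (hB i) s t
  have hξa := integrable_avg (μ := P) (f := fun ω k => ξ ω k ^ 2) fun k => (hξ2 k).1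
  have hZa := integrable_avg (μ := P)
    (f := fun ω k => ∫ r in (t : ℝ)..(s : ℝ), (W k r.toNNReal ω - W k t ω) ^ 2) fun k => (hZ k).1
  set κ := 192 * C ^ 2 * Real.exp (lam - 2 * KV) ^ 2 with hκ
  have hκ0 : 0 ≤ κ := by positivity
  have hA₀ : Integrable (fun ω => 1 + ξ ω i ^ 2) P := (integrable_const _).add (hξ2 i).1
  have hA : Integrable (fun ω => 1 + ξ ω i ^ 2 + avg fun k => ξ ω k ^ 2) P := hA₀.add hξa
  have hD : Integrable (fun ω => (∫ r in (t : ℝ)..(s : ℝ), (W i r.toNNReal ω - W i t ω) ^ 2)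
      + avg fun k => ∫ r in (t : ℝ)..(s : ℝ), (W k r.toNNReal ω - W k t ω) ^ 2) P :=
    (hZ i).1.add hZa
  have hAD : Integrable (fun ω => d * (1 + ξ ω i ^ 2 + avg fun k => ξ ω k ^ 2)
      + σ ^ 2 * ((∫ r in (t : ℝ)..(s : ℝ), (W i r.toNNReal ω - W i t ω) ^ 2)
        + avg fun k => ∫ r in (t : ℝ)..(s : ℝ), (W k r.toNNReal ω - W k t ω) ^ 2)) P :=
    (hA.const_mul d).add (hD.const_mul (σ ^ 2))
  have hR := (hinc.const_mul (2 * σ ^ 2)).add ((hAD.const_mul d).const_mul κ)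
  have hle : ∀ᵐ ω ∂P, (X s ω i - ξ ω i) ^ 2 ≤ 2 * σ ^ 2 * (W i s ω - W i t ω) ^ 2
      + κ * (d * (d * (1 + ξ ω i ^ 2 + avg fun k => ξ ω k ^ 2)
        + σ ^ 2 * ((∫ r in (t : ℝ)..(s : ℝ), (W i r.toNNReal ω - W i t ω) ^ 2)
          + avg fun k => ∫ r in (t : ℝ)..(s : ℝ), (W k r.toNNReal ω - W k t ω) ^ 2))) := by
    filter_upwards [hX.continuousOn, hX.equation, ae_all_iff.2 fun k => (hW.brownian k).cont]
      with ω hc he hw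
    exact sq_displacement_le (w := fun k r => W k r ω) (x := fun r => X r ω) h hKC hU0 hU2 hts hst
      hw hc he i
  have hXm : Measurable fun ω => (X s ω i - ξ ω i) ^ 2 :=
    (((measurable_pi_apply i).comp ((hX.adapted s hts).mono (ℱ.le s) le_rfl)).sub
      ((measurable_pi_apply i).comp (hξm.mono (ℱ.le t) le_rfl))).pow_const 2
  have hint : Integrable (fun ω => (X s ω i - ξ ω i) ^ 2) P :=
    hR.mono' hXm.aestronglyMeasurable (hle.mono fun ω hω => by
      rw [Real.norm_eq_abs, abs_sq]; exact hω)
  refine ⟨hint, (integral_mono_ae hint hR hle).trans ?_⟩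
  have hξavg : ∫ ω, avg (fun k => ξ ω k ^ 2) ∂P ≤ 1 + M := by
    rw [integral_avg (f := fun ω k => ξ ω k ^ 2) fun k => (hξ2 k).1]
    exact (avg_mono fun k => (hξ2 k).2).trans_eq (avg_const _)
  have hZavg : ∫ ω, avg (fun k => ∫ r in (t : ℝ)..(s : ℝ), (W k r.toNNReal ω - W k t ω) ^ 2) ∂P
      ≤ d ^ 2 := by
    rw [integral_avg (f := fun ω k => ∫ r in (t : ℝ)..(s : ℝ), (W k r.toNNReal ω - W k t ω) ^ 2)
      fun k => (hZ k).1]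
    exact (avg_mono fun k => (hZ k).2).trans_eq (avg_const _)
  have hAint : ∫ ω, (1 + ξ ω i ^ 2 + avg fun k => ξ ω k ^ 2) ∂P ≤ 1 + 2 * (1 + M) := by
    rw [integral_add hA₀ hξa,
      integral_add (integrable_const _) (hξ2 i).1]
    simp only [integral_const, probReal_univ, smul_eq_mul, one_mul]
    linarith [(hξ2 i).2]
  have hDint : ∫ ω, ((∫ r in (t : ℝ)..(s : ℝ), (W i r.toNNReal ω - W i t ω) ^ 2)
      + avg fun k => ∫ r in (t : ℝ)..(s : ℝ), (W k r.toNNReal ω - W k t ω) ^ 2) ∂P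
      ≤ 2 * d := by
    rw [integral_add (hZ i).1 hZa]
    have := (hZ i).2
    nlinarith
  simp only [Pi.add_apply]
  rw [integral_add (hinc.const_mul _) ((hAD.const_mul d).const_mul κ)]
  simp only [integral_const_mul]
  rw [integral_add (hA.const_mul d) (hD.const_mul (σ ^ 2)), integral_const_mul, integral_const_mul,
    integral_sq_brownian_sub (hB i) hts, ← hd]
  have h1 := mul_le_mul_of_nonneg_left hAint hh
  have h2 := mul_le_mul_of_nonneg_left hDint (sq_nonneg σ)
  have h3 := mul_le_mul_of_nonneg_left (mul_le_mul_of_nonneg_left (add_le_add h1 h2) hh) hκ0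
  have hM0 : 0 ≤ M := (integral_nonneg fun ω => by positivity).trans (hM i)
  -- The drift contributes order `d ^ 2`, absorbed into `d` because `d ≤ 1`; the order `d` itself
  -- comes from the Brownian increment.
  have h4 : κ * (d * (d * (1 + 2 * (1 + M)) + σ ^ 2 * (2 * d)))
      ≤ κ * (1 + 2 * (1 + M) + 2 * σ ^ 2) * d := by
    have h5 : d * (d * (1 + 2 * (1 + M)) + σ ^ 2 * (2 * d))
        = d * (d * (1 + 2 * (1 + M) + 2 * σ ^ 2)) := by ring
    have h6 : d * (1 + 2 * (1 + M) + 2 * σ ^ 2) ≤ 1 * (1 + 2 * (1 + M) + 2 * σ ^ 2) :=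
      mul_le_mul_of_nonneg_right hst (by positivity)
    rw [h5]
    have := mul_le_mul_of_nonneg_left (mul_le_mul_of_nonneg_left h6 hh) hκ0
    linarith
  linarith

/-- Mean square estimate of each entry of the difference of the first variations. -/
theorem IsFirstVariation.integral_sq_sub_le {U V : ℝ → ℝ} {lam KV C σ K : ℝ}
    (h : PotentialAssumption U V lam KV) (hKC : KV ≤ C) (hU2 : ∀ x, |deriv (deriv U) x| ≤ C)
    (hU3 : ∀ x y, |deriv (deriv U) x - deriv (deriv U) y| ≤ C * |x - y|)
    (hV3 : ∀ x y, |deriv (deriv V) x - deriv (deriv V) y| ≤ C * |x - y|)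
    {N : ℕ} {Ω : Type*} {m : MeasurableSpace Ω}
    {P : Measure Ω} [IsProbabilityMeasure P] {ℱ : Filtration ℝ≥0 m} {W : Fin N → ℝ≥0 → Ω → ℝ}
    {t s T : ℝ≥0} (hts : t ≤ s) (hsT : s ≤ T) (hst : (s : ℝ) - t ≤ 1) {ξ : Ω → Fin N → ℝ}
    {Xt Xs : ℝ≥0 → Ω → Fin N → ℝ} {Jt Js : ℝ≥0 → Ω → Fin N → Fin N → ℝ}
    (hXt : IsParticleFlow P ℱ U V σ W t ξ Xt) (hXs : IsParticleFlow P ℱ U V σ W s ξ Xs)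
    (hJt : IsFirstVariation P ℱ U V t Xt Jt) (hJs : IsFirstVariation P ℱ U V s Xs Js)
    (hK : ∀ i, Integrable (fun ω => (Xt s ω i - ξ ω i) ^ 2) P ∧
      ∫ ω, (Xt s ω i - ξ ω i) ^ 2 ∂P ≤ K * ((s : ℝ) - t)) (i j : Fin N) :
    MemLp (fun ω => Jt T ω i j - Js T ω i j) 2 P ∧
      ∫ ω, |Jt T ω i j - Js T ω i j| ^ 2 ∂P ≤ 2704 * C ^ 2 * (1 + (lam - 2 * KV)⁻¹ ^ 2)
        * (1 + 3 * K) * ((s : ℝ) - t) * Real.exp (-(lam - 2 * KV) * (T - s)) ^ 2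
        * weight j i ^ 2 := by
  have : NeZero N := ⟨fun h0 => by subst h0; exact i.elim0⟩
  have hh : 0 ≤ (s : ℝ) - t := sub_nonneg.2 hts
  set d := (s : ℝ) - t with hd
  set E := Real.exp (-(lam - 2 * KV) * (T - s)) with hE
  have hE0 : 0 < E := Real.exp_pos _
  set ι := (lam - 2 * KV)⁻¹ with hι
  have hι0 : 0 ≤ ι := inv_nonneg.2 (by linarith [h.seven_mul_KV_le, h.KV_pos])
  have hC : 0 < C := h.KV_pos.trans_le hKC
  set κ := E ^ 2 * weight j i ^ 2 * (2704 * C ^ 2 * (1 + ι ^ 2)) with hκ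
  have hκ0 : 0 ≤ κ := by positivity
  have hle : ∀ᵐ ω ∂P, |Jt T ω i j - Js T ω i j| ^ 2 ≤ κ * (d ^ 2 + (Xt s ω i - ξ ω i) ^ 2
      + (Xt s ω j - ξ ω j) ^ 2 + avg fun k => (Xt s ω k - ξ ω k) ^ 2) := by
    filter_upwards [hXt.continuousOn, hXt.equation, hXs.continuousOn, hXs.equation,
      hJt.continuousOn, hJt.equation, hJs.continuousOn, hJs.equation]
      with ω h1 h2 h3 h4 h5 h6 h7 h8
    have hp := abs_firstVariation_sub_le (w := fun k r => W k r ω) (x := fun r => Xt r ω)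
      (y := fun r => Xs r ω) (J := fun r => Jt r ω) (J' := fun r => Js r ω)
      h hKC hU2 hU3 hV3 hts h1 h3 h2 h4 h5 h7 h6 h8 hsT i j
    refine (pow_le_pow_left₀ (abs_nonneg _) hp 2).trans ?_
    have hav := avg_sq_le fun k => |Xt s ω k - ξ ω k|
    simp only [sq_abs] at hav
    rw [← sq_abs (Xt s ω i - ξ ω i), ← sq_abs (Xt s ω j - ξ ω j)]
    set a := |Xt s ω i - ξ ω i|
    set b := |Xt s ω j - ξ ω j|
    set c := avg fun k => |Xt s ω k - ξ ω k|
    set q := avg fun k => (Xt s ω k - ξ ω k) ^ 2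
    have h9 : (12 * d + ι * (4 * a + 4 * b + 26 * c)) ^ 2
        ≤ 2 * (144 * d ^ 2 + ι ^ 2 * (4 * a + 4 * b + 26 * c) ^ 2) := by
      nlinarith [sq_nonneg (12 * d - ι * (4 * a + 4 * b + 26 * c))]
    -- The constant 1352 = 2·26² is generous; `c ^ 2 ≤ q` is Jensen's inequality `hav`.
    have h10 : (4 * a + 4 * b + 26 * c) ^ 2 ≤ 1352 * (a ^ 2 + b ^ 2 + q) := by
      nlinarith [sq_nonneg (a - b), sq_nonneg (a - c), sq_nonneg (b - c), sq_nonneg a,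
        sq_nonneg b, sq_nonneg c]
    have h11 := mul_le_mul_of_nonneg_left h10 (sq_nonneg ι)
    have hq : 0 ≤ q := (sq_nonneg c).trans hav
    have h12 : (12 * d + ι * (4 * a + 4 * b + 26 * c)) ^ 2
        ≤ 2704 * (1 + ι ^ 2) * (d ^ 2 + a ^ 2 + b ^ 2 + q) := by
      have := mul_nonneg (sq_nonneg ι) (sq_nonneg d)
      nlinarith [sq_nonneg d, sq_nonneg a, sq_nonneg b]
    have h13 := mul_le_mul_of_nonneg_left h12
      (by positivity : 0 ≤ E ^ 2 * weight j i ^ 2 * C ^ 2)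
    simp only [hκ]
    calc _ = E ^ 2 * weight j i ^ 2 * C ^ 2 * (12 * d + ι * (4 * a + 4 * b + 26 * c)) ^ 2 := by ring
      _ ≤ _ := h13
      _ = _ := by ring
  have hav := integrable_avg (μ := P) (f := fun ω k => (Xt s ω k - ξ ω k) ^ 2) fun k => (hK k).1
  have h1 : Integrable (fun ω => d ^ 2 + (Xt s ω i - ξ ω i) ^ 2) P :=
    (integrable_const _).add (hK i).1
  have h2 : Integrable (fun ω => d ^ 2 + (Xt s ω i - ξ ω i) ^ 2 + (Xt s ω j - ξ ω j) ^ 2) P :=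
    h1.add (hK j).1
  have h3 : Integrable (fun ω => d ^ 2 + (Xt s ω i - ξ ω i) ^ 2 + (Xt s ω j - ξ ω j) ^ 2
      + avg fun k => (Xt s ω k - ξ ω k) ^ 2) P := h2.add hav
  have hm : Measurable fun ω => Jt T ω i j - Js T ω i j :=
    (measurable_pi_iff.1 (measurable_pi_iff.1
      ((hJt.adapted T (hts.trans hsT)).mono (ℱ.le T) le_rfl) i) j).sub
    (measurable_pi_iff.1 (measurable_pi_iff.1 ((hJs.adapted T hsT).mono (ℱ.le T) le_rfl) i) j)
  have hint : Integrable (fun ω => |Jt T ω i j - Js T ω i j| ^ 2) P :=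
    (h3.const_mul κ).mono' (hm.abs.pow_const 2).aestronglyMeasurable (hle.mono fun ω hω => by
      rw [Real.norm_eq_abs, abs_sq]; exact hω)
  refine ⟨(memLp_two_iff_integrable_sq hm.aestronglyMeasurable).2 (by simpa using hint),
    (integral_mono_ae hint (h3.const_mul κ) hle).trans ?_⟩
  rw [integral_const_mul, integral_add h2 hav, integral_add h1 (hK j).1,
    integral_add (integrable_const _) (hK i).1,
    integral_avg (f := fun ω k => (Xt s ω k - ξ ω k) ^ 2) fun k => (hK k).1]
  have h4 : (avg fun k => ∫ ω, (Xt s ω k - ξ ω k) ^ 2 ∂P) ≤ K * d :=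
    (avg_mono fun k => (hK k).2).trans_eq (avg_const _)
  have h5 : d ^ 2 ≤ d := by nlinarith
  simp only [integral_const, probReal_univ, smul_eq_mul, one_mul]
  calc _ ≤ κ * ((1 + 3 * K) * d) :=
        mul_le_mul_of_nonneg_left (by linarith [(hK i).2, (hK j).2]) hκ0
    _ = _ := by simp only [hκ]; ring

/-! ### Choice of rates and constants -/

theorem proposition4p3 (U V : ℝ → ℝ) (lam KV σ lam1 : ℝ) (hUV : PotentialAssumption U V lam KV)
    (hlam1 : lam1 ∈ Set.Ioo 0 lam) :
    ∃ lam2 ∈ Set.Ioo 0 (min (lam - 2 * KV) lam1),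
    ∃ lam3 ∈ Set.Ioo 0 (min (lam - 2 * KV) lam2),
    ∀ M : ℝ, ∃ K : ℝ, 0 < K ∧
      ∀ (N : ℕ) (Ω : Type*) (m : MeasurableSpace Ω) (P : Measure Ω) (_ : IsProbabilityMeasure P)
        (ℱ : Filtration ℝ≥0 m) (W : Fin N → ℝ≥0 → Ω → ℝ) (_ : IsFilteredBrownian P ℱ W)
        (t s T : ℝ≥0) (_ : t ≤ s) (_ : s ≤ T) (_ : (s : ℝ) - (t : ℝ) < 1)
        (ξ : Ω → Fin N → ℝ) (_ : Measurable[ℱ t] ξ)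
        (_ : ∀ i, MemLp (fun ω => ξ ω i) 4 P)
        (_ : ∀ i k, IdentDistrib (fun ω => ξ ω i) (fun ω => ξ ω k) P P)
        (_ : ∀ i, ∫ ω, |ξ ω i| ^ 4 ∂P ≤ M)
        (Xt Xs : ℝ≥0 → Ω → Fin N → ℝ) (Jt Js : ℝ≥0 → Ω → Fin N → Fin N → ℝ)
        (_ : IsParticleFlow P ℱ U V σ W t ξ Xt) (_ : IsParticleFlow P ℱ U V σ W s ξ Xs)
        (_ : IsFirstVariation P ℱ U V t Xt Jt) (_ : IsFirstVariation P ℱ U V s Xs Js)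
        (j : Fin N),
        (∀ i, MemLp (fun ω => Jt T ω i j - Js T ω i j) 2 P) ∧
        ∑ i, ∫ ω, |Jt T ω i j - Js T ω i j| ^ 2 ∂P
          ≤ K * ((s : ℝ) - t) * Real.exp (-2 * lam2 * ((T : ℝ) - s)) ∧
        ∑ i ∈ Finset.univ.erase j, ∫ ω, |Jt T ω i j - Js T ω i j| ^ 2 ∂P
          ≤ K * ((s : ℝ) - t) / N * Real.exp (-2 * lam3 * ((T : ℝ) - s)) := by
  obtain ⟨C, hC, hKC, hU0, hU2, hU3, hV3⟩ := hUV.exists_common_bound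
  have hν : 0 < lam - 2 * KV := by linarith [hUV.seven_mul_KV_le, hUV.KV_pos]
  have hmin : 0 < min (lam - 2 * KV) lam1 := lt_min hν hlam1.1
  -- Both bounds hold at rate `lam - 2 * KV`; halving serves only to land in the prescribed open
  -- intervals.
  set lam2 := min (lam - 2 * KV) lam1 / 2 with hlam2
  have h2pos : 0 < lam2 := half_pos hmin
  have h2ν : lam2 ≤ lam - 2 * KV := (half_le_self hmin.le).trans (min_le_left _ _)
  refine ⟨lam2, ⟨h2pos, half_lt_self hmin⟩, lam2 / 2,
    ⟨half_pos h2pos, lt_min (by linarith) (by linarith)⟩, fun M => ?_⟩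
  -- `|M|` keeps the constant positive for negative `M` too.
  set K₁ := 2 * σ ^ 2 + 192 * C ^ 2 * Real.exp (lam - 2 * KV) ^ 2
    * (1 + 2 * (1 + |M|) + 2 * σ ^ 2) with hK₁
  set K₂ := 2704 * C ^ 2 * (1 + (lam - 2 * KV)⁻¹ ^ 2) * (1 + 3 * K₁) with hK₂
  have hK₂0 : 0 < K₂ := by positivity
  -- The 5 is the bound of `sum_weight_sq_le`, needed for the full sum only.
  refine ⟨5 * K₂, by positivity, ?_⟩
  intro N Ω m P _ ℱ W hW t s T hts hsT hst ξ hξm hξ _ hM Xt Xs Jt Js hXt hXs hJt hJs j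
  have hN : (0 : ℝ) < N := Nat.cast_pos.2 (Fin.pos j)
  have hd : 0 ≤ (s : ℝ) - t := sub_nonneg.2 hts
  have hTs : 0 ≤ (T : ℝ) - s := sub_nonneg.2 hsT
  have hent := fun i => IsFirstVariation.integral_sq_sub_le hUV hKC hU2 hU3 hV3 hts hsT hst.le
    hXt hXs hJt hJs (fun k => hXt.integral_sq_displacement_le hUV hKC hU0 hU2 hW hts hst.le hξm hξ
      (fun k => (hM k).trans (le_abs_self M)) k) i j
  have hexp : ∀ l, l ≤ lam - 2 * KV →
      Real.exp (-(lam - 2 * KV) * (T - s)) ^ 2 ≤ Real.exp (-2 * l * ((T : ℝ) - s)) := by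
    intro l hl
    rw [← Real.exp_nat_mul, Real.exp_le_exp]
    have := mul_le_mul_of_nonneg_right hl hTs
    push_cast
    linarith
  have hbase : 0 ≤ K₂ * ((s : ℝ) - t) := by positivity
  refine ⟨fun i => (hent i).1, ?_, ?_⟩
  · refine (Finset.sum_le_sum fun i _ => (hent i).2).trans ?_
    rw [← Finset.mul_sum]
    refine (mul_le_mul (mul_le_mul_of_nonneg_left (hexp lam2 h2ν) hbase) (sum_weight_sq_le j)
      (Finset.sum_nonneg fun _ _ => sq_nonneg _) (by positivity)).trans_eq ?_
    ring
  · refine (Finset.sum_le_sum fun i _ => (hent i).2).trans ?_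
    rw [← Finset.mul_sum]
    refine (mul_le_mul (mul_le_mul_of_nonneg_left (hexp (lam2 / 2) (by linarith)) hbase)
      (sum_erase_weight_sq_le j) (Finset.sum_nonneg fun _ _ => sq_nonneg _)
      (by positivity)).trans ?_
    have : 0 ≤ K₂ * ((s : ℝ) - t) * Real.exp (-2 * (lam2 / 2) * ((T : ℝ) - s)) * (1 / N) := by
      positivity
    calc _ ≤ 5 * (K₂ * ((s : ℝ) - t) * Real.exp (-2 * (lam2 / 2) * ((T : ℝ) - s)) * (1 / N)) := by
          linarith
      _ = _ := by ring
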